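/- Let $M$ be a connected (finite-dimensional, smooth) manifold and $\omega\in\Omega^3(M)$ a 2-plectic form, i.e. $d\omega=0$ and $u\mapsto\iota_u\omega$ is injective on each $T_pM$. A 1-form $\alpha$ is Hamiltonian if $d\alpha=-\iota_{v_\alpha}\omega$ for a (necessarily unique) vector field $v_\alpha$; write $\Omega^1_{\rm Ham}(M)$ for the space of such forms. The Lie 2-algebra $L_\infty(M,\omega)$ has $\Omega^1_{\rm Ham}(M)$ in degree $0$ and $C^\infty(M)$ in degree $-1$, unary bracket $d$, and on Hamiltonian forms $[\alpha,\beta]'=\iota_{v_\beta}\iota_{v_\alpha}\omega$, $[\alpha,\beta,\gamma]'=-\iota_{v_\gamma}\iota_{v_\beta}\iota_{v_\alpha}\omega$. Let $L=\mathfrak h[1]\oplus\mathfrak g$ be a minimal Lie 2-algebra with $\mathfrak g,\mathfrak h$ finite-dimensional and real: a Lie algebra $\mathfrak g$, a representation $[x,h]=-[h,x]$ of $\mathfrak g$ on $\mathfrak h$, and a trinary bracket $[\cdot,\cdot,\cdot]:\wedge^3\mathfrak g\to\mathfrak h$ that is a Chevalley–Eilenberg 3-cocycle with values in $\mathfrak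 h$. Let $\mathfrak g\to\mathfrak X(M)$, $x\mapsto v_x$, be a Lie algebra morphism such that every $\iota_{v_x}\omega$ is exact (so each $v_x$ is a Hamiltonian vector field). A moment map for $L$ is an $L_\infty$-morphism $L\to L_\infty(M,\omega)$ with $-\iota_{v_x}\omega=d(f_1(x))$ for $x\in\mathfrak g$. Explicitly, it is a triple of linear maps $f_1|_{\mathfrak g}:\mathfrak g\to\Omega^1_{\rm Ham}(M)$, $f_1|_{\mathfrak h}:\mathfrak h\to C^\infty(M)$, $f_2:\wedge^2\mathfrak g\to C^\infty(M)$ such that, for all $x,y,z\in\mathfrak g$ and $h\in\mathfrak h$, $d(f_1(x))=-\iota_{v_x}\omega$, $d(f_1(h))=0$, $f_1([h,x])=0$, $d(f_2(x,y))=f_1([x,y])-[f_1(x),f_1(y)]'$ and $$f_1([x,y,z])-[f_1(x),f_1(y),f_1(z)]'=f_2(x,[y,z])-f_2(y,[x,z])+f_2(z,[x,y]).$$ Let $CE(L)=S^{\bullet\ge1}(\mathfrak h[2]\oplus\mathfrak g[1])^*$ be the Chevalley–Eilenberg complex, with $d_{CE}=-d_2+d_3$, $d_i\xi=\xi\circ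 l_i$, where $l_i$ is extended to the graded symmetric algebra by summing over $(i,n-i)$-unshuffles with Koszul signs from $l_2(x,y)=[x,y]$, $l_2(x,h)=l_2(h,x)=[x,h]$, $l_3(x,y,z)=-[x,y,z]$ (all other values of $l_2,l_3$ on generators being zero). Let $C=CE(L)\otimes\Omega(M)$ be graded by total degree, with $d_{tot}=d_{CE}\otimes1+1\otimes d_{dR}$, where $(1\otimes d_{dR})(\xi\otimes\alpha)=(-1)^{|\xi|}\xi\otimes d\alpha$. For $1\le k\le3$ put $\omega_k(x_1,\dots,x_k)=\iota_{v_{x_k}}\cdots\iota_{v_{x_1}}\omega$, and let $\widetilde\omega=\sum_{k=1}^3(-1)^{k-1}\omega_k\in C^3$. An element $\mu\in C^2=\mathfrak g[1]^*\otimes\Omega^1(M)\oplus(\mathfrak h[2]^*\oplus S^2(\mathfrak g[1])^*)\otimes C^\infty(M)$ is the same as the triple of its components $\mu_1|_{\mathfrak g}:\mathfrak g\to\Omega^1(M)$, $\mu_1|_{\mathfrak h}:\mathfrak h\to C^\infty(M)$, $\mu_2:\wedge^2\mathfrak g\to C^\infty(M)$. For every $\mu\in C^2$ one has $d_{tot}\mu=\widetilde\omega$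 if and only if $(\mu_1|_{\mathfrak g},\mu_1|_{\mathfrak h},\mu_2)$ are the components of a moment map for $L$. Hence taking components is a bijection $$\{\mu\in C^2:\ d_{tot}\mu=\widetilde\omega\}\;\cong\;\{\text{moment maps for }\mathfrak h[1]\oplus\mathfrak g\}.$$ In particular, the moment maps form a (possibly empty) affine subspace of the space of all triples of linear maps $\mathfrak g\to\Omega^1(M)$, $\mathfrak h\to C^\infty(M)$, $\wedge^2\mathfrak g\to C^\infty(M)$; if it is nonempty, its space of translations consists of the component triples of the $d_{tot}$-closed elements of $C^2$. -/

import Mathlib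

open scoped Manifold ContDiff Topology TensorProduct
noncomputable section

section Forms
variable {E : Type*} [NormedAddCommGroup E] [NormedSpace ℝ E]
  {M : Type*} [TopologicalSpace M] [ChartedSpace E M]

/-- A not necessarily smooth differential `k`-form on a manifold `M` modelled on `E` (without
boundary): an alternating `k`-linear form on every tangent space. -/
def RawForm (E : Type*) [NormedAddCommGroup E] [NormedSpace ℝ E]
    (M : Type*) [TopologicalSpace M] [ChartedSpace E M] (k : ℕ) : Type _ :=
  ∀ x : M, TangentSpace 𝓘(ℝ, E) x [⋀^Fin k]→L[ℝ] ℝ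

instance RawForm.instAddCommGroup (k : ℕ) : AddCommGroup (RawForm E M k) :=
  inferInstanceAs (AddCommGroup (M → E [⋀^Fin k]→L[ℝ] ℝ))

instance RawForm.instModule (k : ℕ) : Module ℝ (RawForm E M k) :=
  inferInstanceAs (Module ℝ (M → E [⋀^Fin k]→L[ℝ] ℝ))

/-- The representative of a form in the chart at `a`, i.e. its pullback along the inverse of that
chart. Only its values on the target of the chart are relevant. -/
def RawForm.inChart {k : ℕ} (α : RawForm E M k) (a : M) : E → E [⋀^Fin k]→L[ℝ] ℝ :=
  fun y => (α ((extChartAt 𝓘(ℝ, E) a).symm y)).compContinuousLinearMap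
    (mfderiv 𝓘(ℝ, E) 𝓘(ℝ, E) (extChartAt 𝓘(ℝ, E) a).symm y)

theorem RawForm.inChart_add {k : ℕ} (α β : RawForm E M k) (a : M) :
    RawForm.inChart (α + β) a = RawForm.inChart α a + RawForm.inChart β a := by
  rfl

theorem RawForm.inChart_smul {k : ℕ} (c : ℝ) (α : RawForm E M k) (a : M) :
    RawForm.inChart (c • α) a = c • RawForm.inChart α a := by
  rfl

/-- The space `Ω^k(M)` of smooth `k`-forms: all chart representatives are `C^∞`. For `k = 0` this is
`C^∞(M)`. -/
def Form (E : Type*) [NormedAddCommGroup E] [NormedSpace ℝ E]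
    (M : Type*) [TopologicalSpace M] [ChartedSpace E M] (k : ℕ) :
    Submodule ℝ (RawForm E M k) where
  carrier := {α | ∀ a : M, ContDiffOn ℝ ∞ (RawForm.inChart α a) (extChartAt 𝓘(ℝ, E) a).target}
  add_mem' := fun hα hβ a => (hα a).add (hβ a)
  zero_mem' := fun _ => contDiffOn_const (c := (0 : E [⋀^Fin k]→L[ℝ] ℝ))
  smul_mem' := fun c _ hα a => (hα a).const_smul c

/-- The de Rham differential of a form, computed at each point in the chart at this point. By
`inChart_d` below, for a smooth form it agrees with the exterior derivative of the representative in
any chart. -/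
def RawForm.d {k : ℕ} (α : RawForm E M k) : RawForm E M (k + 1) :=
  fun x => (extDeriv (RawForm.inChart α x) (extChartAt 𝓘(ℝ, E) x x)).compContinuousLinearMap
    (mfderiv 𝓘(ℝ, E) 𝓘(ℝ, E) (extChartAt 𝓘(ℝ, E) x) x)

theorem inChart_diffAt {k : ℕ} (α : Form E M k) (p : M) :
    DifferentiableAt ℝ (RawForm.inChart α.1 p) (extChartAt 𝓘(ℝ, E) p p) :=
  ((α.2 p).contDiffAt ((isOpen_extChartAt_target p).mem_nhds (mem_extChartAt_target p))
    ).differentiableAt (by simp)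

variable [IsManifold 𝓘(ℝ, E) ∞ M]

theorem mdiffAt_chart_symm (a : M) {y : E} (hy : y ∈ (extChartAt 𝓘(ℝ, E) a).target) :
    MDifferentiableAt 𝓘(ℝ, E) 𝓘(ℝ, E) (extChartAt 𝓘(ℝ, E) a).symm y := by
  have : IsManifold 𝓘(ℝ, E) 1 M := IsManifold.of_le (n := ∞) (by simp)
  have h := mdifferentiableWithinAt_extChartAt_symm (I := 𝓘(ℝ, E)) hy
  rwa [modelWithCornersSelf_coe, Set.range_id, mdifferentiableWithinAt_univ] at h

theorem mdiffAt_chart (a : M) {p : M} (hp : p ∈ (extChartAt 𝓘(ℝ, E) a).source) :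
    MDifferentiableAt 𝓘(ℝ, E) 𝓘(ℝ, E) (extChartAt 𝓘(ℝ, E) a) p := by
  have : IsManifold 𝓘(ℝ, E) 1 M := IsManifold.of_le (n := ∞) (by simp)
  exact mdifferentiableAt_extChartAt (by simpa using hp)

theorem fderiv_coordChange (a b : M) {y : E}
    (hy : y ∈ (extChartAt 𝓘(ℝ, E) a).target)
    (hb : (extChartAt 𝓘(ℝ, E) a).symm y ∈ (extChartAt 𝓘(ℝ, E) b).source) :
    fderiv ℝ (fun z => extChartAt 𝓘(ℝ, E) b ((extChartAt 𝓘(ℝ, E) a).symm z)) y =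
      (mfderiv 𝓘(ℝ, E) 𝓘(ℝ, E) (extChartAt 𝓘(ℝ, E) b) ((extChartAt 𝓘(ℝ, E) a).symm y)).comp
        (mfderiv 𝓘(ℝ, E) 𝓘(ℝ, E) (extChartAt 𝓘(ℝ, E) a).symm y) := by
  rw [← mfderiv_eq_fderiv]
  exact mfderiv_comp y (mdiffAt_chart b hb) (mdiffAt_chart_symm a hy)

theorem inChart_coordChange {k : ℕ} (α : RawForm E M k) (a b : M) {y : E}
    (hy : y ∈ (extChartAt 𝓘(ℝ, E) a).target)
    (hb : (extChartAt 𝓘(ℝ, E) a).symm y ∈ (extChartAt 𝓘(ℝ, E) b).source) :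
    RawForm.inChart α a y =
      (RawForm.inChart α b (extChartAt 𝓘(ℝ, E) b ((extChartAt 𝓘(ℝ, E) a).symm y))
        ).compContinuousLinearMap
        (fderiv ℝ (fun z => extChartAt 𝓘(ℝ, E) b ((extChartAt 𝓘(ℝ, E) a).symm z)) y) := by
  have : IsManifold 𝓘(ℝ, E) 1 M := IsManifold.of_le (n := ∞) (by simp)
  have key : ∀ (p q : M) (_ : q = p) (L N : E →L[ℝ] E), N = L →
      (show E [⋀^Fin k]→L[ℝ] ℝ from α p).compContinuousLinearMap L =
      (show E [⋀^Fin k]→L[ℝ] ℝ from α q).compContinuousLinearMap N := by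
    rintro p q rfl L N rfl; rfl
  rw [fderiv_coordChange a b hy hb]
  refine key _ _ ((extChartAt 𝓘(ℝ, E) b).left_inv hb) _ (ContinuousLinearMap.comp _ (ContinuousLinearMap.comp _ _)) ?_
  have h := mfderivWithin_extChartAt_symm_comp_mfderiv_extChartAt' (I := 𝓘(ℝ, E)) hb
  rw [modelWithCornersSelf_coe, Set.range_id, mfderivWithin_univ] at h
  refine (ContinuousLinearMap.comp_assoc (M₁ := E) (M₂ := E) (M₃ := E) (M₄ := E) _ _ _).symm.trans ?_
  have h' := congrArg (fun L : E →L[ℝ] E => L.comp (show E →L[ℝ] E from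
    mfderiv 𝓘(ℝ, E) 𝓘(ℝ, E) (extChartAt 𝓘(ℝ, E) a).symm y)) h
  exact h'

/-- In every chart, the de Rham differential is the exterior derivative of the representative. -/
theorem inChart_d {k : ℕ} (α : Form E M k) (a : M) {y : E}
    (hy : y ∈ (extChartAt 𝓘(ℝ, E) a).target) :
    RawForm.inChart (RawForm.d α.1) a y = extDeriv (RawForm.inChart α.1 a) y := by
  set p : M := (extChartAt 𝓘(ℝ, E) a).symm y with hp
  have hpb : p ∈ (extChartAt 𝓘(ℝ, E) p).source := mem_extChartAt_source p
  have htgt : extChartAt 𝓘(ℝ, E) p p ∈ (extChartAt 𝓘(ℝ, E) p).target := mem_extChartAt_target p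
  have hsmooth : ContDiffAt ℝ ∞
      (fun z => extChartAt 𝓘(ℝ, E) p ((extChartAt 𝓘(ℝ, E) a).symm z)) y := by
    rw [← contMDiffAt_iff_contDiffAt]
    have h1 : ContMDiffAt 𝓘(ℝ, E) 𝓘(ℝ, E) ∞ (extChartAt 𝓘(ℝ, E) a).symm y :=
      (contMDiffOn_extChartAt_symm a).contMDiffAt ((isOpen_extChartAt_target a).mem_nhds hy)
    have h2 : ContMDiffAt 𝓘(ℝ, E) 𝓘(ℝ, E) ∞ (extChartAt 𝓘(ℝ, E) p)
        ((extChartAt 𝓘(ℝ, E) a).symm y) := contMDiffAt_extChartAt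
    exact ContMDiffAt.comp y h2 h1
  have hev : RawForm.inChart α.1 a =ᶠ[𝓝 y] fun z =>
      (RawForm.inChart α.1 p (extChartAt 𝓘(ℝ, E) p ((extChartAt 𝓘(ℝ, E) a).symm z))
        ).compContinuousLinearMap
        (fderiv ℝ (fun z => extChartAt 𝓘(ℝ, E) p ((extChartAt 𝓘(ℝ, E) a).symm z)) z) := by
    have hcont : ContinuousAt (extChartAt 𝓘(ℝ, E) a).symm y :=
      continuousAt_extChartAt_symm'' hy
    filter_upwards [(isOpen_extChartAt_target a).mem_nhds hy,
      hcont.preimage_mem_nhds ((isOpen_extChartAt_source p).mem_nhds hpb)] with z hz hz'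
    exact inChart_coordChange α.1 a p hz hz'
  rw [hev.extDeriv_eq]
  have hdiff : DifferentiableAt ℝ (RawForm.inChart α.1 p)
      (extChartAt 𝓘(ℝ, E) p ((extChartAt 𝓘(ℝ, E) a).symm y)) :=
    ((α.2 p).contDiffAt ((isOpen_extChartAt_target p).mem_nhds htgt)).differentiableAt (by simp)
  refine Eq.trans ?_ (extDeriv_pullback (E := E) (F := E)
    (f := fun z => extChartAt 𝓘(ℝ, E) p ((extChartAt 𝓘(ℝ, E) a).symm z))
    hdiff hsmooth (by simpa using (WithTop.coe_le_coe.2 le_top : ((2 : ℕ∞) : WithTop ℕ∞) ≤ ∞))).symm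
  rw [fderiv_coordChange a p hy hpb]
  rfl

theorem d_mem {k : ℕ} (α : Form E M k) : RawForm.d α.1 ∈ Form E M (k + 1) := by
  intro a
  have h1 : ContDiffOn ℝ ∞ (extDeriv (RawForm.inChart α.1 a)) (extChartAt 𝓘(ℝ, E) a).target := by
    have := (α.2 a).fderiv_of_isOpen (m := ∞) (isOpen_extChartAt_target a) (by simp)
    exact (ContinuousAlternatingMap.alternatizeUncurryFinCLM ℝ E ℝ (n := k)).contDiff.comp_contDiffOn this
  exact h1.congr fun y hy => inChart_d α a hy

/-- The de Rham differential `Ω^k(M) → Ω^{k+1}(M)`. -/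
def Form.d {k : ℕ} : Form E M k →ₗ[ℝ] Form E M (k + 1) where
  toFun α := ⟨RawForm.d α.1, d_mem α⟩
  map_add' α β := by
    apply Subtype.ext
    funext x
    change (extDeriv (RawForm.inChart α.1 x + RawForm.inChart β.1 x) _).compContinuousLinearMap _ = _
    rw [extDeriv_add (inChart_diffAt α x) (inChart_diffAt β x)]
    rfl
  map_smul' c α := by
    apply Subtype.ext
    funext x
    change (extDeriv (c • RawForm.inChart α.1 x) _).compContinuousLinearMap _ = _
    rw [extDeriv_smul]
    rfl

/-- Smooth vector fields on `M`. -/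
abbrev VectorFld (E : Type*) [NormedAddCommGroup E] [NormedSpace ℝ E]
    (M : Type*) [TopologicalSpace M] [ChartedSpace E M] [IsManifold 𝓘(ℝ, E) ∞ M] : Type _ :=
  ContMDiffSection 𝓘(ℝ, E) E ∞ (TangentSpace 𝓘(ℝ, E) : M → Type _)

/-- The contraction `ι_X α = α(X, ·, …, ·)`. -/
def RawForm.contract {k : ℕ} (X : ∀ x : M, TangentSpace 𝓘(ℝ, E) x) (α : RawForm E M (k + 1)) :
    RawForm E M k :=
  fun x => ContinuousAlternatingMap.curryLeft (E := E) (α x) (X x)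

theorem contDiff_curryLeft {k : ℕ} :
    ContDiff ℝ ∞ (fun η : E [⋀^Fin (k + 1)]→L[ℝ] ℝ => η.curryLeft) := by
  have h : IsBoundedLinearMap ℝ (fun η : E [⋀^Fin (k + 1)]→L[ℝ] ℝ => η.curryLeft) :=
    ⟨⟨fun _ _ => rfl, fun _ _ => rfl⟩, 1, one_pos, fun η => by simp⟩
  exact h.contDiff

theorem contract_mem [FiniteDimensional ℝ E] {k : ℕ} (X : VectorFld E M) (α : Form E M (k + 1)) :
    RawForm.contract X α.1 ∈ Form E M k := by
  have : IsManifold 𝓘(ℝ, E) 1 M := IsManifold.of_le (n := ∞) (by simp)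
  have : CompleteSpace E := FiniteDimensional.complete ℝ E
  intro a
  let W : E → E := fun y => VectorField.mpullback 𝓘(ℝ, E) 𝓘(ℝ, E) (extChartAt 𝓘(ℝ, E) a).symm X y
  have hinv : ∀ y ∈ (extChartAt 𝓘(ℝ, E) a).target,
      (mfderiv 𝓘(ℝ, E) 𝓘(ℝ, E) (extChartAt 𝓘(ℝ, E) a).symm y).IsInvertible := by
    intro y hy
    simpa using isInvertible_mfderivWithin_extChartAt_symm (I := 𝓘(ℝ, E)) hy
  have hW : ContDiffOn ℝ ∞ W (extChartAt 𝓘(ℝ, E) a).target := by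
    intro y hy
    have h := ContMDiffAt.mpullback_vectorField_preimage (m := ∞) (n := ∞) (X.contMDiff _)
      ((contMDiffOn_extChartAt_symm (n := ∞) a).contMDiffAt
        ((isOpen_extChartAt_target a).mem_nhds hy)) (hinv y hy) (by simp)
    exact (contMDiffAt_vectorSpace_iff_contDiffAt.1 h).contDiffWithinAt
  have h1 : ContDiffOn ℝ ∞
      (fun y => (RawForm.inChart α.1 a y).curryLeft (W y)) (extChartAt 𝓘(ℝ, E) a).target := by
    have hL := contDiff_curryLeft (E := E) (k := k)
    have h2 : ContDiffOn ℝ ∞ (fun y => (RawForm.inChart α.1 a y).curryLeft)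
        (extChartAt 𝓘(ℝ, E) a).target := hL.comp_contDiffOn (α.2 a)
    exact h2.clm_apply hW
  refine h1.congr fun y hy => ?_
  have h3 : (mfderiv 𝓘(ℝ, E) 𝓘(ℝ, E) (extChartAt 𝓘(ℝ, E) a).symm y) (W y) =
      X ((extChartAt 𝓘(ℝ, E) a).symm y) := by
    exact (hinv y hy).self_apply_inverse _
  change ContinuousAlternatingMap.compContinuousLinearMap (M := E) (M' := E)
    (ContinuousAlternatingMap.curryLeft (E := E) (α.1 ((extChartAt 𝓘(ℝ, E) a).symm y))
      (X ((extChartAt 𝓘(ℝ, E) a).symm y))) _ = _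
  rw [← h3]
  exact (ContinuousAlternatingMap.curryLeft_compContinuousLinearMap (E := E) (F := E) _ _ _).symm

/-- The contraction `ι_X α` of a smooth form with a smooth vector field. -/
def Form.contract [FiniteDimensional ℝ E] {k : ℕ} :
    VectorFld E M →ₗ[ℝ] Form E M (k + 1) →ₗ[ℝ] Form E M k :=
  LinearMap.mk₂ ℝ (fun X α => ⟨RawForm.contract X α.1, contract_mem X α⟩)
    (fun X Y α => Subtype.ext (funext fun x => (ContinuousAlternatingMap.curryLeft (E := E) (α.1 x)).map_add (X x) (Y x)))
    (fun c X α => Subtype.ext (funext fun x => (ContinuousAlternatingMap.curryLeft (E := E) (α.1 x)).map_smul c (X x)))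
    (fun _ _ _ => Subtype.ext (funext fun _ => rfl))
    (fun _ _ _ => Subtype.ext (funext fun _ => rfl))
end Forms

/-- A minimal Lie 2-algebra `𝔥[1] ⊕ 𝔤` (an `L_∞`-algebra in degrees `0` and `-1` with vanishing unary
bracket): a Lie algebra `𝔤`, a binary bracket `[x, h] = act x h` (with `[h, x] = -[x, h]`) and a
trinary bracket `⋀³ 𝔤 → 𝔥`, satisfying the higher Jacobi identities, which say that `𝔥` is a
representation of `𝔤` and that the trinary bracket is a 3-cocycle with values in it. -/
structure MinimalLieTwoAlgebra (𝔤 𝔥 : Type*) [LieRing 𝔤] [LieAlgebra ℝ 𝔤]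
    [AddCommGroup 𝔥] [Module ℝ 𝔥] where
  act : 𝔤 →ₗ[ℝ] 𝔥 →ₗ[ℝ] 𝔥
  trinary : 𝔤 [⋀^Fin 3]→ₗ[ℝ] 𝔥
  act_lie : ∀ (x y : 𝔤) (h : 𝔥), act ⁅x, y⁆ h - act x (act y h) + act y (act x h) = 0
  trinary_cocycle : ∀ x y z u : 𝔤,
    act x (trinary ![y, z, u]) - act y (trinary ![x, z, u]) + act z (trinary ![x, y, u])
        - act u (trinary ![x, y, z])
      = trinary ![⁅x, y⁆, z, u] + trinary ![y, ⁅x, z⁆, u] + trinary ![y, z, ⁅x, u⁆]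
        - trinary ![x, ⁅y, z⁆, u] - trinary ![x, z, ⁅y, u⁆] + trinary ![x, y, ⁅z, u⁆]

section Words
variable {𝔤 𝔥 : Type*}

/-- Minus the degree of a homogeneous element of `𝔥[2] ⊕ 𝔤[1]`, where elements of `𝔥` have degree
`-2` and elements of `𝔤` have degree `-1`. Products of homogeneous elements are encoded as words,
i.e. lists of elements of `𝔥` or `𝔤`. -/
def wt : 𝔥 ⊕ 𝔤 → ℕ
  | Sum.inl _ => 2
  | Sum.inr _ => 1

/-- Minus the degree of a product of homogeneous elements. -/
def wordWt (w : List (𝔥 ⊕ 𝔤)) : ℕ := (w.map wt).sum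

theorem wordWt_cons (x : 𝔥 ⊕ 𝔤) (w : List (𝔥 ⊕ 𝔤)) : wordWt (x :: w) = wt x + wordWt w := by
  simp [wordWt]

theorem wordWt_append (u w : List (𝔥 ⊕ 𝔤)) : wordWt (u ++ w) = wordWt u + wordWt w := by
  simp [wordWt]

/-- All `(k, n - k)`-unshuffles of a word of length `n`: each is listed with its Koszul sign, the
subword formed by the `k` chosen letters, and the subword formed by the remaining letters. When the
first letter `x` is not chosen, it has to be moved past the chosen subword, which gives the sign
`(-1)^{|x| |subword|}`. -/
def unshuffles : ℕ → List (𝔥 ⊕ 𝔤) → List (ℝ × List (𝔥 ⊕ 𝔤) × List (𝔥 ⊕ 𝔤))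
  | 0, w => [(1, [], w)]
  | _ + 1, [] => []
  | k + 1, x :: w =>
      (unshuffles k w).map (fun s => (s.1, x :: s.2.1, s.2.2)) ++
      (unshuffles (k + 1) w).map
        (fun s => ((-1) ^ (wt x * wordWt s.2.1) * s.1, s.2.1, x :: s.2.2))

variable {W : Type*} [AddCommGroup W] [Module ℝ W]

/-- The sum over all `(k, n - k)`-unshuffles `σ` of a word `x₁ … x_n`, with Koszul signs, of
`F(x_{σ(1)} … x_{σ(k)}, x_{σ(k+1)} … x_{σ(n)})`. -/
def unshuffleSum (k : ℕ) (F : List (𝔥 ⊕ 𝔤) → List (𝔥 ⊕ 𝔤) → W) (w : List (𝔥 ⊕ 𝔤)) : W :=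
  ((unshuffles k w).map fun s => s.1 • F s.2.1 s.2.2).sum

theorem unshuffleSum_zero (F : List (𝔥 ⊕ 𝔤) → List (𝔥 ⊕ 𝔤) → W) (w : List (𝔥 ⊕ 𝔤)) :
    unshuffleSum 0 F w = F [] w := by
  simp [unshuffleSum, unshuffles]

theorem unshuffleSum_nil (k : ℕ) (F : List (𝔥 ⊕ 𝔤) → List (𝔥 ⊕ 𝔤) → W) :
    unshuffleSum (k + 1) F [] = 0 := by
  simp [unshuffleSum, unshuffles]

theorem unshuffleSum_cons (k : ℕ) (F : List (𝔥 ⊕ 𝔤) → List (𝔥 ⊕ 𝔤) → W) (x : 𝔥 ⊕ 𝔤)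
    (w : List (𝔥 ⊕ 𝔤)) :
    unshuffleSum (k + 1) F (x :: w) = unshuffleSum k (fun u r => F (x :: u) r) w +
      unshuffleSum (k + 1)
        (fun u r => (-1 : ℝ) ^ (wt x * wordWt u) • F u (x :: r)) w := by
  simp only [unshuffleSum, unshuffles, List.map_append, List.sum_append, List.map_map]
  congr 2
  apply List.map_congr_left
  intro s _
  simp [smul_smul, mul_comm]

theorem unshuffleSum_add (k : ℕ) (F G : List (𝔥 ⊕ 𝔤) → List (𝔥 ⊕ 𝔤) → W) (w : List (𝔥 ⊕ 𝔤)) :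
    unshuffleSum k (fun u r => F u r + G u r) w = unshuffleSum k F w + unshuffleSum k G w := by
  simp only [unshuffleSum, smul_add, List.sum_map_add]

theorem unshuffleSum_smul (k : ℕ) (c : ℝ) (F : List (𝔥 ⊕ 𝔤) → List (𝔥 ⊕ 𝔤) → W)
    (w : List (𝔥 ⊕ 𝔤)) :
    unshuffleSum k (fun u r => c • F u r) w = c • unshuffleSum k F w := by
  simp only [unshuffleSum, smul_comm _ c, List.smul_sum, List.map_map]
  rfl

theorem unshuffleSum_eq_zero (k : ℕ) (F : List (𝔥 ⊕ 𝔤) → List (𝔥 ⊕ 𝔤) → W) (w : List (𝔥 ⊕ 𝔤))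
    (hF : ∀ u r, wordWt u + wordWt r = wordWt w → F u r = 0) : unshuffleSum k F w = 0 := by
  induction w generalizing k F with
  | nil =>
    cases k with
    | zero => rw [unshuffleSum_zero]; exact hF _ _ (by simp [wordWt])
    | succ k => rw [unshuffleSum_nil]
  | cons x w ih =>
    cases k with
    | zero => rw [unshuffleSum_zero]; exact hF _ _ (by simp [wordWt])
    | succ k =>
      rw [unshuffleSum_cons, ih, ih, add_zero]
      · intro u r h
        rw [hF u (x :: r) (by rw [wordWt_cons, wordWt_cons]; omega), smul_zero]
      · intro u r h
        exact hF _ _ (by rw [wordWt_cons, wordWt_cons]; omega)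

variable [AddCommGroup 𝔤] [Module ℝ 𝔤] [AddCommGroup 𝔥] [Module ℝ 𝔥]

/-- A function on words is multilinear and graded symmetric, that is, it comes from a linear map on
the graded symmetric algebra `S(𝔥[2] ⊕ 𝔤[1])`. -/
structure IsGradedSymm (ξ : List (𝔥 ⊕ 𝔤) → W) : Prop where
  lin_h : ∀ (u t : List (𝔥 ⊕ 𝔤)) (c : ℝ) (h h' : 𝔥),
    ξ (u ++ Sum.inl (c • h + h') :: t) = c • ξ (u ++ Sum.inl h :: t) + ξ (u ++ Sum.inl h' :: t)
  lin_g : ∀ (u t : List (𝔥 ⊕ 𝔤)) (c : ℝ) (x x' : 𝔤),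
    ξ (u ++ Sum.inr (c • x + x') :: t) = c • ξ (u ++ Sum.inr x :: t) + ξ (u ++ Sum.inr x' :: t)
  swap : ∀ (u t : List (𝔥 ⊕ 𝔤)) (a b : 𝔥 ⊕ 𝔤),
    ξ (u ++ a :: b :: t) = (-1 : ℝ) ^ (wt a * wt b) • ξ (u ++ b :: a :: t)

/-- Linear maps `S^{≥1}(𝔥[2] ⊕ 𝔤[1]) → W` of degree `p`, i.e. which vanish on products of degree
different from `-p`. For `W = ℝ` this is the degree `p` part `CE(L)^p` of
`S^{≥1}(𝔥[2] ⊕ 𝔤[1])^*`. -/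
def Cochain (𝔤 𝔥 : Type*) [AddCommGroup 𝔤] [Module ℝ 𝔤] [AddCommGroup 𝔥] [Module ℝ 𝔥]
    (p : ℕ) (W : Type*) [AddCommGroup W] [Module ℝ W] : Submodule ℝ (List (𝔥 ⊕ 𝔤) → W) where
  carrier := {ξ | IsGradedSymm ξ ∧ ξ [] = 0 ∧ ∀ w, wordWt w ≠ p → ξ w = 0}
  add_mem' := by
    rintro ξ η ⟨hξ, hξ0, hξp⟩ ⟨hη, hη0, hηp⟩
    refine ⟨⟨fun u t c h h' => ?_, fun u t c x x' => ?_, fun u t a b => ?_⟩, by simp [hξ0, hη0],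
      fun w hw => by simp [hξp w hw, hηp w hw]⟩
    · simp only [Pi.add_apply, hξ.lin_h, hη.lin_h, smul_add]; abel
    · simp only [Pi.add_apply, hξ.lin_g, hη.lin_g, smul_add]; abel
    · simp only [Pi.add_apply, hξ.swap u t a b, hη.swap u t a b, smul_add]
  zero_mem' := ⟨⟨by simp, by simp, by simp⟩, rfl, fun _ _ => rfl⟩
  smul_mem' := by
    rintro r ξ ⟨hξ, hξ0, hξp⟩
    refine ⟨⟨fun u t c h h' => ?_, fun u t c x x' => ?_, fun u t a b => ?_⟩, by simp [hξ0],
      fun w hw => by simp [hξp w hw]⟩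
    · simp only [Pi.smul_apply, hξ.lin_h, smul_add, smul_comm c r]
    · simp only [Pi.smul_apply, hξ.lin_g, smul_add, smul_comm c r]
    · simp only [Pi.smul_apply, hξ.swap u t a b, smul_comm r]

theorem IsGradedSymm.cons {ξ : List (𝔥 ⊕ 𝔤) → W} (hξ : IsGradedSymm ξ) (x : 𝔥 ⊕ 𝔤) :
    IsGradedSymm (fun w => ξ (x :: w)) :=
  ⟨fun u => hξ.lin_h (x :: u), fun u => hξ.lin_g (x :: u), fun u => hξ.swap (x :: u)⟩

theorem IsGradedSymm.sign {ξ : List (𝔥 ⊕ 𝔤) → W} (hξ : IsGradedSymm ξ) (x : 𝔥 ⊕ 𝔤) :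
    IsGradedSymm (fun w => (-1 : ℝ) ^ (wt x * wordWt w) • ξ w) := by
  refine ⟨fun u t c h h' => ?_, fun u t c y y' => ?_, fun u t a b => ?_⟩
  · simp only [wordWt_append, wordWt_cons, wt, hξ.lin_h, smul_add, smul_comm c]
  · simp only [wordWt_append, wordWt_cons, wt, hξ.lin_g, smul_add, smul_comm c]
  · simp only [wordWt_append, wordWt_cons, hξ.swap u t a b, smul_smul]
    rw [mul_comm, add_left_comm (wt a)]

theorem isGradedSymm_unshuffleSum (k : ℕ) {F : List (𝔥 ⊕ 𝔤) → List (𝔥 ⊕ 𝔤) → W}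
    (h₁ : ∀ r, IsGradedSymm (fun u => F u r)) (h₂ : ∀ u, IsGradedSymm (F u)) :
    IsGradedSymm (unshuffleSum k F) := by
  have hA : ∀ (u t : List (𝔥 ⊕ 𝔤)) (c : ℝ) (a b e : 𝔥 ⊕ 𝔤)
      (_ : wt a = wt e) (_ : wt b = wt e) (k : ℕ) (F : List (𝔥 ⊕ 𝔤) → List (𝔥 ⊕ 𝔤) → W)
      (_ : ∀ r u t, F (u ++ e :: t) r = c • F (u ++ a :: t) r + F (u ++ b :: t) r)
      (_ : ∀ r u t, F r (u ++ e :: t) = c • F r (u ++ a :: t) + F r (u ++ b :: t)),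
      unshuffleSum k F (u ++ e :: t) = c • unshuffleSum k F (u ++ a :: t) +
        unshuffleSum k F (u ++ b :: t) := by
    intro u t c a b e ha hb
    induction u with
    | nil =>
      rintro (_ | k) F H₁ H₂
      · simpa only [unshuffleSum_zero] using H₂ [] [] t
      · simp only [List.nil_append, unshuffleSum_cons, ha, hb]
        have e₁ : (fun u r => F (e :: u) r) = fun u r => c • F (a :: u) r + F (b :: u) r := by
          funext u r; exact H₁ r [] u
        have e₂ : (fun u r => (-1 : ℝ) ^ (wt e * wordWt u) • F u (e :: r)) =
            fun u r => c • ((-1 : ℝ) ^ (wt e * wordWt u) • F u (a :: r)) +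
              (-1 : ℝ) ^ (wt e * wordWt u) • F u (b :: r) := by
          funext u r
          have := H₂ u [] r
          simp only [List.nil_append] at this
          rw [this, smul_add, smul_comm]
        rw [e₁, e₂]
        simp only [unshuffleSum_add, unshuffleSum_smul, smul_add]
        abel
    | cons x u ih =>
      rintro (_ | k) F H₁ H₂
      · simpa only [unshuffleSum_zero] using H₂ [] (x :: u) t
      · simp only [List.cons_append, unshuffleSum_cons]
        rw [ih k _ (fun r u t => H₁ r (x :: u) t) (fun r u t => H₂ (x :: r) u t),
          ih (k + 1) _ (fun r u t => ?_) (fun r u t => ?_), smul_add]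
        · abel
        · simp only [wordWt_append, wordWt_cons, ha, hb, H₁, smul_add, smul_comm c]
        · have := H₂ r (x :: u) t
          simp only [List.cons_append] at this
          simp only [this, smul_add, smul_comm c]
  have hB : ∀ (u t : List (𝔥 ⊕ 𝔤)) (a b : 𝔥 ⊕ 𝔤) (k : ℕ)
      (F : List (𝔥 ⊕ 𝔤) → List (𝔥 ⊕ 𝔤) → W)
      (_ : ∀ r, IsGradedSymm (fun u => F u r)) (_ : ∀ u, IsGradedSymm (F u)),
      unshuffleSum k F (u ++ a :: b :: t) =
        (-1 : ℝ) ^ (wt a * wt b) • unshuffleSum k F (u ++ b :: a :: t) := by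
    intro u t a b
    have hsq : (-1 : ℝ) ^ (wt a * wt b) * (-1 : ℝ) ^ (wt a * wt b) = 1 := by
      rw [← mul_pow]; norm_num
    induction u with
    | nil =>
      intro k F H₁ H₂
      have last : (fun u r => (-1 : ℝ) ^ (wt b * wordWt u) •
            ((-1 : ℝ) ^ (wt a * wordWt u) • F u (a :: b :: r))) =
          fun u r => (-1 : ℝ) ^ (wt a * wt b) • ((-1 : ℝ) ^ (wt a * wordWt u) •
            ((-1 : ℝ) ^ (wt b * wordWt u) • F u (b :: a :: r))) := by
        funext u r
        have := (H₂ u).swap [] r a b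
        simp only [List.nil_append] at this
        rw [this]
        simp only [smul_smul]
        congr 1
        ring
      have mid₁ : (fun u r => (-1 : ℝ) ^ (wt b * wordWt u) • F (a :: u) (b :: r)) =
          fun u r => (-1 : ℝ) ^ (wt a * wt b) •
            ((-1 : ℝ) ^ (wt b * wordWt (a :: u)) • F (a :: u) (b :: r)) := by
        funext u r
        simp only [smul_smul, wordWt_cons, mul_add, pow_add, mul_comm (wt b) (wt a)]
        rw [← mul_assoc, hsq, one_mul]
      have mid₂ : (fun u r => (-1 : ℝ) ^ (wt a * wordWt (b :: u)) • F (b :: u) (a :: r)) =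
          fun u r => (-1 : ℝ) ^ (wt a * wt b) •
            ((-1 : ℝ) ^ (wt a * wordWt u) • F (b :: u) (a :: r)) := by
        funext u r
        simp only [smul_smul, wordWt_cons, mul_add, pow_add]
      rcases k with _ | _ | k
      · simpa only [unshuffleSum_zero] using (H₂ []).swap [] t a b
      · simp only [List.nil_append, unshuffleSum_cons, unshuffleSum_zero]
        rw [last, unshuffleSum_smul]
        simp only [wordWt_cons, mul_add, pow_add, smul_add, smul_smul, mul_comm (wt b) (wt a)]
        simp only [wordWt, List.map_nil, List.sum_nil, mul_zero, pow_zero, mul_one, hsq, one_smul]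
        abel
      · simp only [List.nil_append, unshuffleSum_cons]
        rw [last, mid₁, mid₂]
        have e₁ : (fun u r => F (a :: b :: u) r) =
            fun u r => (-1 : ℝ) ^ (wt a * wt b) • F (b :: a :: u) r := by
          funext u r; exact (H₁ r).swap [] u a b
        rw [e₁]
        simp only [unshuffleSum_smul, smul_add]
        abel
    | cons x u ih =>
      rintro (_ | k) F H₁ H₂
      · simpa only [unshuffleSum_zero] using (H₂ []).swap (x :: u) t a b
      · simp only [List.cons_append, unshuffleSum_cons]
        rw [ih k _ (fun r => (H₁ r).cons x) (fun u => H₂ (x :: u)),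
          ih (k + 1) _ (fun r => (H₁ (x :: r)).sign x) (fun u => ?_), smul_add]
        have h := (H₂ u).cons x
        exact ⟨fun u' t c h' h'' => by rw [h.lin_h]; simp only [smul_add, smul_comm c],
          fun u' t c h' h'' => by rw [h.lin_g]; simp only [smul_add, smul_comm c],
          fun u' t a b => by rw [h.swap]; rw [smul_comm]⟩
  exact ⟨fun u t c h h' => hA u t c (Sum.inl h) (Sum.inl h') (Sum.inl (c • h + h')) rfl rfl k F
      (fun r u t => (h₁ r).lin_h u t c h h') (fun r u t => (h₂ r).lin_h u t c h h'),
    fun u t c h h' => hA u t c (Sum.inr h) (Sum.inr h') (Sum.inr (c • h + h')) rfl rfl k F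
      (fun r u t => (h₁ r).lin_g u t c h h') (fun r u t => (h₂ r).lin_g u t c h h'),
    fun u t a b => hB u t a b k F h₁ h₂⟩
end Words

section CE
variable {𝔤 𝔥 : Type*} [LieRing 𝔤] [LieAlgebra ℝ 𝔤] [AddCommGroup 𝔥] [Module ℝ 𝔥]
  {W : Type*} [AddCommGroup W] [Module ℝ W]

/-- The map `l₂(x, y) = [x, y]`, `l₂(x, h) = [x, h]`, `l₂(h, x) = -[h, x] = [x, h]`, `l₂(h, h') = 0`
on words of length two. -/
def MinimalLieTwoAlgebra.l₂ (L : MinimalLieTwoAlgebra 𝔤 𝔥) : List (𝔥 ⊕ 𝔤) → 𝔥 ⊕ 𝔤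
  | [Sum.inr x, Sum.inr y] => Sum.inr ⁅x, y⁆
  | [Sum.inr x, Sum.inl h] => Sum.inl (L.act x h)
  | [Sum.inl h, Sum.inr x] => Sum.inl (L.act x h)
  | _ => Sum.inl 0

/-- The map `l₃(x, y, z) = -[x, y, z]` on words of length three, zero if some entry is in `𝔥`. -/
def MinimalLieTwoAlgebra.l₃ (L : MinimalLieTwoAlgebra 𝔤 𝔥) : List (𝔥 ⊕ 𝔤) → 𝔥 ⊕ 𝔤
  | [Sum.inr x, Sum.inr y, Sum.inr z] => Sum.inl (-L.trinary ![x, y, z])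
  | _ => Sum.inl 0

theorem IsGradedSymm.inl_zero {ξ : List (𝔥 ⊕ 𝔤) → W} (hξ : IsGradedSymm ξ) (t : List (𝔥 ⊕ 𝔤)) :
    ξ (Sum.inl 0 :: t) = 0 := by
  simpa using hξ.lin_h [] t 1 0 0

theorem IsGradedSymm.inl_neg {ξ : List (𝔥 ⊕ 𝔤) → W} (hξ : IsGradedSymm ξ) (t : List (𝔥 ⊕ 𝔤))
    (h : 𝔥) : ξ (Sum.inl (-h) :: t) = -ξ (Sum.inl h :: t) := by
  simpa [hξ.inl_zero] using hξ.lin_h [] t (-1) h 0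

theorem IsGradedSymm.inr_zero {ξ : List (𝔥 ⊕ 𝔤) → W} (hξ : IsGradedSymm ξ) (t : List (𝔥 ⊕ 𝔤)) :
    ξ (Sum.inr 0 :: t) = 0 := by
  simpa using hξ.lin_g [] t 1 0 0

theorem IsGradedSymm.inr_neg {ξ : List (𝔥 ⊕ 𝔤) → W} (hξ : IsGradedSymm ξ) (t : List (𝔥 ⊕ 𝔤))
    (x : 𝔤) : ξ (Sum.inr (-x) :: t) = -ξ (Sum.inr x :: t) := by
  simpa [hξ.inr_zero] using hξ.lin_g [] t (-1) x 0

theorem IsGradedSymm.comp_l₂ (L : MinimalLieTwoAlgebra 𝔤 𝔥) {ξ : List (𝔥 ⊕ 𝔤) → W}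
    (hξ : IsGradedSymm ξ) (r : List (𝔥 ⊕ 𝔤)) : IsGradedSymm (fun u => ξ (L.l₂ u :: r)) := by
  have lh := hξ.lin_h [] r
  have lg := hξ.lin_g [] r
  simp only [List.nil_append] at lh lg
  refine ⟨fun u t c h h' => ?_, fun u t c x x' => ?_, fun u t a b => ?_⟩
  · rcases u with _ | ⟨a | a, _ | ⟨b, u⟩⟩ <;> rcases t with _ | ⟨d | d, _ | ⟨e, t⟩⟩ <;>
      simp [MinimalLieTwoAlgebra.l₂, hξ.inl_zero, lh]
  · rcases u with _ | ⟨a | a, _ | ⟨b, u⟩⟩ <;> rcases t with _ | ⟨d | d, _ | ⟨e, t⟩⟩ <;>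
      simp [MinimalLieTwoAlgebra.l₂, hξ.inl_zero, lh, lg]
  · rcases u with _ | ⟨e, u⟩ 
    · rcases t with _ | ⟨e, t⟩ <;> rcases a with a | a <;> rcases b with b | b <;>
        simp [MinimalLieTwoAlgebra.l₂, hξ.inl_zero, wt]
      rw [← lie_skew, hξ.inr_neg]
    · rcases u with _ | ⟨f, u⟩ <;>
      rcases e with e | e <;> rcases a with a | a <;> rcases b with b | b <;>
        simp [MinimalLieTwoAlgebra.l₂, hξ.inl_zero, wt]

theorem MinimalLieTwoAlgebra.l₃_of_length (L : MinimalLieTwoAlgebra 𝔤 𝔥) (u : List (𝔥 ⊕ 𝔤))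
    (hu : u.length ≠ 3) : L.l₃ u = Sum.inl 0 := by
  unfold MinimalLieTwoAlgebra.l₃
  split
  · simp at hu
  · rfl

theorem IsGradedSymm.comp_l₃ (L : MinimalLieTwoAlgebra 𝔤 𝔥) {ξ : List (𝔥 ⊕ 𝔤) → W}
    (hξ : IsGradedSymm ξ) (r : List (𝔥 ⊕ 𝔤)) : IsGradedSymm (fun u => ξ (L.l₃ u :: r)) := by
  have lh := hξ.lin_h [] r
  have lg := hξ.lin_g [] r
  simp only [List.nil_append] at lh lg
  have up₀ : ∀ a b d e : 𝔤, Function.update ![a, b, d] 0 e = ![e, b, d] := by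
    intro a b d e; ext i; fin_cases i <;> rfl
  have up₁ : ∀ a b d e : 𝔤, Function.update ![a, b, d] 1 e = ![a, e, d] := by
    intro a b d e; ext i; fin_cases i <;> rfl
  have up₂ : ∀ a b d e : 𝔤, Function.update ![a, b, d] 2 e = ![a, b, e] := by
    intro a b d e; ext i; fin_cases i <;> rfl
  have t₀ : ∀ (c : ℝ) (x x' y z : 𝔤), L.trinary ![c • x + x', y, z] =
      c • L.trinary ![x, y, z] + L.trinary ![x', y, z] := by
    intro c x x' y z
    have h₁ := L.trinary.map_update_add ![0, y, z] 0 (c • x) x'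
    have h₂ := L.trinary.map_update_smul ![0, y, z] 0 c x
    simp only [up₀] at h₁ h₂
    rw [h₁, h₂]
  have t₁ : ∀ (c : ℝ) (x x' y z : 𝔤), L.trinary ![y, c • x + x', z] =
      c • L.trinary ![y, x, z] + L.trinary ![y, x', z] := by
    intro c x x' y z
    have h₁ := L.trinary.map_update_add ![y, 0, z] 1 (c • x) x'
    have h₂ := L.trinary.map_update_smul ![y, 0, z] 1 c x
    simp only [up₁] at h₁ h₂
    rw [h₁, h₂]
  have t₂ : ∀ (c : ℝ) (x x' y z : 𝔤), L.trinary ![y, z, c • x + x'] =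
      c • L.trinary ![y, z, x] + L.trinary ![y, z, x'] := by
    intro c x x' y z
    have h₁ := L.trinary.map_update_add ![y, z, 0] 2 (c • x) x'
    have h₂ := L.trinary.map_update_smul ![y, z, 0] 2 c x
    simp only [up₂] at h₁ h₂
    rw [h₁, h₂]
  have s₀ : ∀ x y z : 𝔤, L.trinary ![y, x, z] = -L.trinary ![x, y, z] := by
    intro x y z
    rw [← L.trinary.map_swap ![x, y, z] (show (0 : Fin 3) ≠ 1 by decide)]
    congr 1; ext i; fin_cases i <;> rfl
  have s₁ : ∀ x y z : 𝔤, L.trinary ![x, z, y] = -L.trinary ![x, y, z] := by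
    intro x y z
    rw [← L.trinary.map_swap ![x, y, z] (show (1 : Fin 3) ≠ 2 by decide)]
    congr 1; ext i; fin_cases i <;> rfl
  have lh' : ∀ (c : ℝ) (h h' : 𝔥), ξ (Sum.inl (-(c • h + h')) :: r) =
      c • ξ (Sum.inl (-h) :: r) + ξ (Sum.inl (-h') :: r) := by
    intro c h h'
    rw [hξ.inl_neg, lh, hξ.inl_neg, hξ.inl_neg, smul_neg, neg_add]
  refine ⟨fun u t c h h' => ?_, fun u t c x x' => ?_, fun u t a b => ?_⟩
  · rcases u with _ | ⟨a | a, _ | ⟨b | b, _ | ⟨d, u⟩⟩⟩ <;>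
      rcases t with _ | ⟨e | e, _ | ⟨f | f, _ | ⟨g, t⟩⟩⟩ <;>
      simp [MinimalLieTwoAlgebra.l₃, hξ.inl_zero]
  · rcases u with _ | ⟨a | a, _ | ⟨b | b, _ | ⟨d, u⟩⟩⟩ <;>
      rcases t with _ | ⟨e | e, _ | ⟨f | f, _ | ⟨g, t⟩⟩⟩ <;>
      simp [MinimalLieTwoAlgebra.l₃, hξ.inl_zero, t₀, t₁, t₂, lh', -neg_add_rev]
  · by_cases hlen : (u ++ a :: b :: t).length = 3
    swap
    · have hlen' : (u ++ b :: a :: t).length ≠ 3 := by simpa using hlen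
      simp only [L.l₃_of_length _ hlen, L.l₃_of_length _ hlen', hξ.inl_zero, smul_zero]
    rcases u with _ | ⟨e | e, _ | ⟨f, u⟩⟩ <;>
      rcases t with _ | ⟨g | g, _ | ⟨j, t⟩⟩ <;>
      rcases a with a | a <;> rcases b with b | b <;>
        first
          | (exfalso; simp only [List.length_append, List.length_cons, List.length_nil] at hlen; omega)
          | simp [MinimalLieTwoAlgebra.l₃, hξ.inl_zero, wt]
    · rw [s₀ b a g, neg_neg, hξ.inl_neg, neg_neg]
    · rw [s₁ e b a, neg_neg, hξ.inl_neg, neg_neg]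

theorem MinimalLieTwoAlgebra.apply_l₂ (L : MinimalLieTwoAlgebra 𝔤 𝔥) {p : ℕ}
    (ξ : Cochain 𝔤 𝔥 p W) (u r : List (𝔥 ⊕ 𝔤)) (h : wordWt u + wordWt r ≠ p + 1) :
    ξ.1 (L.l₂ u :: r) = 0 := by
  unfold MinimalLieTwoAlgebra.l₂
  split
  all_goals first
    | exact ξ.2.1.inl_zero r
    | (apply ξ.2.2.2; simp only [wordWt, wt, List.map_cons, List.map_nil, List.sum_cons,
        List.sum_nil] at h ⊢; omega)

theorem MinimalLieTwoAlgebra.apply_l₃ (L : MinimalLieTwoAlgebra 𝔤 𝔥) {p : ℕ}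
    (ξ : Cochain 𝔤 𝔥 p W) (u r : List (𝔥 ⊕ 𝔤)) (h : wordWt u + wordWt r ≠ p + 1) :
    ξ.1 (L.l₃ u :: r) = 0 := by
  unfold MinimalLieTwoAlgebra.l₃
  split
  all_goals first
    | exact ξ.2.1.inl_zero r
    | (apply ξ.2.2.2; simp only [wordWt, wt, List.map_cons, List.map_nil, List.sum_cons,
        List.sum_nil] at h ⊢; omega)

theorem IsGradedSymm.comb {ξ η : List (𝔥 ⊕ 𝔤) → W} (hξ : IsGradedSymm ξ) (hη : IsGradedSymm η) :
    IsGradedSymm (fun w => -ξ w + η w) := by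
  refine ⟨fun u t c h h' => ?_, fun u t c x x' => ?_, fun u t a b => ?_⟩
  · rw [hξ.lin_h, hη.lin_h]; simp only [smul_add, smul_neg]; abel
  · rw [hξ.lin_g, hη.lin_g]; simp only [smul_add, smul_neg]; abel
  · rw [hξ.swap, hη.swap]; simp only [smul_add, smul_neg]

/-- The Chevalley–Eilenberg differential `d_CE = -d₂ + d₃` (the term `d₁` is zero since the unary
bracket is), where `(d_i ξ)(w) = ξ(l_i(w))` and `l_i` is extended to the symmetric algebra by
`l_i(x₁ … x_n) = ∑ ε(σ) l_i(x_{σ(1)}, …, x_{σ(i)}) x_{σ(i+1)} … x_{σ(n)}` over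
`(i, n - i)`-unshuffles. The Chevalley–Eilenberg complex itself is the case `W = ℝ`. -/
def ceD (L : MinimalLieTwoAlgebra 𝔤 𝔥) (p : ℕ) :
    Cochain 𝔤 𝔥 p W →ₗ[ℝ] Cochain 𝔤 𝔥 (p + 1) W where
  toFun ξ := ⟨fun w => -unshuffleSum 2 (fun u r => ξ.1 (L.l₂ u :: r)) w +
      unshuffleSum 3 (fun u r => ξ.1 (L.l₃ u :: r)) w,
    (isGradedSymm_unshuffleSum 2 (fun r => ξ.2.1.comp_l₂ L r) (fun _ => ξ.2.1.cons _)).comb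
      (isGradedSymm_unshuffleSum 3 (fun r => ξ.2.1.comp_l₃ L r) (fun _ => ξ.2.1.cons _)),
    by simp only [unshuffleSum_nil, neg_zero, add_zero],
    fun w hw => by
      change -unshuffleSum 2 _ w + unshuffleSum 3 _ w = 0
      rw [unshuffleSum_eq_zero 2 _ w fun u r h => L.apply_l₂ ξ u r (h ▸ hw),
        unshuffleSum_eq_zero 3 _ w fun u r h => L.apply_l₃ ξ u r (h ▸ hw), neg_zero, add_zero]⟩
  map_add' ξ η := by
    apply Subtype.ext
    funext w
    simp only [Submodule.coe_add, Pi.add_apply, unshuffleSum_add]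
    abel
  map_smul' c ξ := by
    apply Subtype.ext
    funext w
    simp only [Submodule.coe_smul, Pi.smul_apply, unshuffleSum_smul, RingHom.id_apply, smul_add,
      smul_neg]

/-- The canonical map from `CE(L)^p ⊗ W` to cochains of degree `p` with values in `W`. -/
def tensorEval (p : ℕ) : Cochain 𝔤 𝔥 p ℝ ⊗[ℝ] W →ₗ[ℝ] Cochain 𝔤 𝔥 p W :=
  TensorProduct.lift <| LinearMap.mk₂ ℝ
    (fun ξ m => ⟨fun w => ξ.1 w • m, by
      refine ⟨⟨fun u t c h h' => ?_, fun u t c x x' => ?_, fun u t a b => ?_⟩, ?_, fun w hw => ?_⟩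
      · rw [ξ.2.1.lin_h, add_smul, smul_assoc]
      · rw [ξ.2.1.lin_g, add_smul, smul_assoc]
      · rw [ξ.2.1.swap, smul_assoc]
      · change ξ.1 [] • m = 0
        rw [ξ.2.2.1, zero_smul]
      · change ξ.1 w • m = 0
        rw [ξ.2.2.2 w hw, zero_smul]⟩)
    (fun _ _ _ => Subtype.ext (funext fun _ => add_smul _ _ _))
    (fun _ _ _ => Subtype.ext (funext fun _ => mul_smul _ _ _))
    (fun _ _ _ => Subtype.ext (funext fun _ => smul_add _ _ _))
    (fun _ _ _ => Subtype.ext (funext fun _ => smul_comm _ _ _))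

theorem tensorEval_tmul (p : ℕ) (ξ : Cochain 𝔤 𝔥 p ℝ) (m : W) (w : List (𝔥 ⊕ 𝔤)) :
    (tensorEval p (ξ ⊗ₜ[ℝ] m)).1 w = ξ.1 w • m := rfl

/-- Postcomposition of a cochain with a linear map. -/
def cochainMap {W' : Type*} [AddCommGroup W'] [Module ℝ W'] (f : W →ₗ[ℝ] W') {p : ℕ}
    (ξ : Cochain 𝔤 𝔥 p W) : Cochain 𝔤 𝔥 p W' :=
  ⟨fun w => f (ξ.1 w), by
    refine ⟨⟨fun u t c h h' => ?_, fun u t c x x' => ?_, fun u t a b => ?_⟩, ?_, fun w hw => ?_⟩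
    · rw [ξ.2.1.lin_h, map_add, map_smul]
    · rw [ξ.2.1.lin_g, map_add, map_smul]
    · rw [ξ.2.1.swap, map_smul]
    · change f (ξ.1 []) = 0
      rw [ξ.2.2.1, map_zero]
    · change f (ξ.1 w) = 0
      rw [ξ.2.2.2 w hw, map_zero]⟩

theorem tensorEval_injective (p : ℕ) :
    Function.Injective (tensorEval p : Cochain 𝔤 𝔥 p ℝ ⊗[ℝ] W →ₗ[ℝ] Cochain 𝔤 𝔥 p W) := by
  classical
  let b := Module.Basis.ofVectorSpace ℝ W
  rw [injective_iff_map_eq_zero]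
  intro t ht
  let e := TensorProduct.equivFinsuppOfBasisRight (M := Cochain 𝔤 𝔥 p ℝ) b
  have key : ∀ (t : Cochain 𝔤 𝔥 p ℝ ⊗[ℝ] W) (w : List (𝔥 ⊕ 𝔤)) (i),
      b.repr ((tensorEval p t).1 w) i = (e t i).1 w := by
    intro t w i
    induction t with
    | zero => simp
    | add t t' ht ht' => simp [ht, ht']
    | tmul ξ m => simp [e, tensorEval_tmul, mul_comm]
  rw [← e.map_eq_zero_iff]
  ext i w
  rw [← key, ht]
  simp

theorem tensorEval_surjective [FiniteDimensional ℝ 𝔤] [FiniteDimensional ℝ 𝔥] (p : ℕ) :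
    Function.Surjective (tensorEval p : Cochain 𝔤 𝔥 p ℝ ⊗[ℝ] W →ₗ[ℝ] Cochain 𝔤 𝔥 p W) := by
  classical
  let b := Module.Basis.ofVectorSpace ℝ W
  let bg := Module.finBasis ℝ 𝔤
  let bh := Module.finBasis ℝ 𝔥
  let lt : Fin (Module.finrank ℝ 𝔥) ⊕ Fin (Module.finrank ℝ 𝔤) → 𝔥 ⊕ 𝔤 := Sum.map bh bg
  have hfin : {v : List (Fin (Module.finrank ℝ 𝔥) ⊕ Fin (Module.finrank ℝ 𝔤)) |
      v.length ≤ p}.Finite := List.finite_length_le _ p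
  have hlen : ∀ w : List (𝔥 ⊕ 𝔤), w.length ≤ wordWt w := by
    intro w
    induction w with
    | nil => simp
    | cons a w ih => rcases a with a | a <;> simp only [List.length_cons, wordWt_cons, wt] <;> omega
  have det : ∀ ξ : Cochain 𝔤 𝔥 p W,
      (∀ v : List (Fin (Module.finrank ℝ 𝔥) ⊕ Fin (Module.finrank ℝ 𝔤)),
        v.length ≤ p → ξ.1 (v.map lt) = 0) → ξ = 0 := by
    intro ξ hξ
    have hξ' : ∀ v : List (Fin (Module.finrank ℝ 𝔥) ⊕ Fin (Module.finrank ℝ 𝔤)),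
        ξ.1 (v.map lt) = 0 := by
      intro v
      by_cases hv : v.length ≤ p
      · exact hξ v hv
      · apply ξ.2.2.2
        have := hlen (v.map lt)
        rw [List.length_map] at this
        omega
    have main : ∀ (w : List (𝔥 ⊕ 𝔤))
        (v : List (Fin (Module.finrank ℝ 𝔥) ⊕ Fin (Module.finrank ℝ 𝔤))), ξ.1 (v.map lt ++ w) = 0 := by
      intro w
      induction w with
      | nil => intro v; simpa using hξ' v
      | cons a w ih =>
        intro v
        rcases a with h | x
        · let f : 𝔥 →ₗ[ℝ] W :=
            { toFun := fun h => ξ.1 (v.map lt ++ Sum.inl h :: w)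
              map_add' := fun h h' => by simpa using ξ.2.1.lin_h (v.map lt) w 1 h h'
              map_smul' := fun c h => by
                have h0 : ξ.1 (v.map lt ++ Sum.inl 0 :: w) = 0 := by
                  simpa using ξ.2.1.lin_h (v.map lt) w 1 0 0
                simpa [h0] using ξ.2.1.lin_h (v.map lt) w c h 0 }
          have hf : f = 0 := bh.ext fun i => by
            have := ih (v ++ [Sum.inl i])
            change ξ.1 (v.map lt ++ Sum.inl (bh i) :: w) = 0
            simpa [lt] using this
          exact congrArg (fun g : 𝔥 →ₗ[ℝ] W => g h) hf
        · let f : 𝔤 →ₗ[ℝ] W :=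
            { toFun := fun h => ξ.1 (v.map lt ++ Sum.inr h :: w)
              map_add' := fun h h' => by simpa using ξ.2.1.lin_g (v.map lt) w 1 h h'
              map_smul' := fun c h => by
                have h0 : ξ.1 (v.map lt ++ Sum.inr 0 :: w) = 0 := by
                  simpa using ξ.2.1.lin_g (v.map lt) w 1 0 0
                simpa [h0] using ξ.2.1.lin_g (v.map lt) w c h 0 }
          have hf : f = 0 := bg.ext fun i => by
            have := ih (v ++ [Sum.inr i])
            change ξ.1 (v.map lt ++ Sum.inr (bg i) :: w) = 0
            simpa [lt] using this
          exact congrArg (fun g : 𝔤 →ₗ[ℝ] W => g x) hf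
    apply Subtype.ext
    funext w
    simpa using main w []
  intro ξ
  let S : Finset _ := hfin.toFinset.biUnion fun v => (b.repr (ξ.1 (v.map lt))).support
  refine ⟨∑ i ∈ S, (cochainMap (b.coord i) ξ) ⊗ₜ[ℝ] b i, ?_⟩
  rw [← sub_eq_zero]
  refine det _ fun v hv => ?_
  have hsum : ∀ w, (tensorEval p (∑ i ∈ S, (cochainMap (b.coord i) ξ) ⊗ₜ[ℝ] b i)).1 w =
      ∑ i ∈ S, b.repr (ξ.1 w) i • b i := by
    intro w
    rw [map_sum]
    simp only [AddSubmonoidClass.coe_finsetSum, Finset.sum_apply, tensorEval_tmul]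
    rfl
  have hsub : (b.repr (ξ.1 (v.map lt))).support ⊆ S := by
    intro i hi
    exact Finset.mem_biUnion.2 ⟨v, hfin.mem_toFinset.2 hv, hi⟩
  have h2 : ∑ i ∈ S, b.repr (ξ.1 (v.map lt)) i • b i = ξ.1 (v.map lt) := by
    conv_rhs => rw [← b.linearCombination_repr (ξ.1 (v.map lt))]
    rw [Finsupp.linearCombination_apply, Finsupp.sum]
    symm
    refine Finset.sum_subset hsub fun i _ hi => ?_
    rw [Finsupp.notMem_support_iff.1 hi, zero_smul]
  change (tensorEval p _).1 _ - ξ.1 _ = 0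
  rw [hsum, h2, sub_self]

/-- The canonical identification of `CE(L)^p ⊗ W` with cochains of degree `p` with values in `W`. -/
def tensorEquiv [FiniteDimensional ℝ 𝔤] [FiniteDimensional ℝ 𝔥] (p : ℕ) :
    Cochain 𝔤 𝔥 p ℝ ⊗[ℝ] W ≃ₗ[ℝ] Cochain 𝔤 𝔥 p W :=
  LinearEquiv.ofBijective (tensorEval p) ⟨tensorEval_injective p, tensorEval_surjective p⟩

/-- A cochain of degree 1 is determined by its values on `𝔤`. -/
def Cochain.onG : Cochain 𝔤 𝔥 1 W →ₗ[ℝ] (𝔤 →ₗ[ℝ] W) where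
  toFun ξ :=
    { toFun := fun x => ξ.1 [Sum.inr x]
      map_add' := fun x y => by simpa using ξ.2.1.lin_g [] [] 1 x y
      map_smul' := fun c x => by simpa [ξ.2.1.inr_zero] using ξ.2.1.lin_g [] [] c x 0 }
  map_add' _ _ := rfl
  map_smul' _ _ := rfl

/-- The `𝔥`-part of a cochain of degree 2. -/
def Cochain.onH : Cochain 𝔤 𝔥 2 W →ₗ[ℝ] (𝔥 →ₗ[ℝ] W) where
  toFun ξ :=
    { toFun := fun h => ξ.1 [Sum.inl h]
      map_add' := fun x y => by simpa using ξ.2.1.lin_h [] [] 1 x y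
      map_smul' := fun c x => by simpa [ξ.2.1.inl_zero] using ξ.2.1.lin_h [] [] c x 0 }
  map_add' _ _ := rfl
  map_smul' _ _ := rfl

/-- The `⋀² 𝔤`-part of a cochain of degree 2. -/
def Cochain.onGG : Cochain 𝔤 𝔥 2 W →ₗ[ℝ] (𝔤 [⋀^Fin 2]→ₗ[ℝ] W) where
  toFun ξ :=
    { toFun := fun x => ξ.1 [Sum.inr (x 0), Sum.inr (x 1)]
      map_update_add' := fun m i x y => by
        have h₀ := ξ.2.1.lin_g [] [Sum.inr (m 1)] 1 x y
        have h₁ := ξ.2.1.lin_g [Sum.inr (m 0)] [] 1 x y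
        fin_cases i
        · simpa using h₀
        · simpa using h₁
      map_update_smul' := fun m i c x => by
        have h₀ := ξ.2.1.lin_g [] [Sum.inr (m 1)] c x 0
        have h₁ := ξ.2.1.lin_g [Sum.inr (m 0)] [] c x 0
        have h₂ := ξ.2.1.lin_g [Sum.inr (m 0)] [] 1 0 0
        simp at h₂
        fin_cases i
        · simpa [ξ.2.1.inr_zero] using h₀
        · simpa [h₂] using h₁
      map_eq_zero_of_eq' := fun m i j hij hne => by
        have h01 : m 0 = m 1 := by
          fin_cases i <;> fin_cases j <;> simp_all
        have h := ξ.2.1.swap [] [] (Sum.inr (m 1)) (Sum.inr (m 1))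
        simp only [List.nil_append, wt, mul_one, pow_one, neg_smul, one_smul] at h
        rw [h01]
        have h2 : (2 : ℝ) • ξ.1 [Sum.inr (m 1), Sum.inr (m 1)] = 0 := by
          rw [two_smul]
          exact eq_neg_iff_add_eq_zero.1 h
        exact (smul_eq_zero.1 h2).resolve_left two_ne_zero }
  map_add' _ _ := rfl
  map_smul' _ _ := rfl
end CE

section Multisymplectic
variable {E : Type*} [NormedAddCommGroup E] [NormedSpace ℝ E] [FiniteDimensional ℝ E]
  {M : Type*} [TopologicalSpace M] [ChartedSpace E M] [IsManifold 𝓘(ℝ, E) ∞ M]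

/-- `ϖ` is a 2-plectic form: a closed 3-form such that `u ↦ ι_u ϖ` is injective on every tangent
space. -/
def Is2Plectic (ϖ : Form E M 3) : Prop :=
  Form.d ϖ = 0 ∧
    ∀ x : M, Function.Injective
      (fun u : TangentSpace 𝓘(ℝ, E) x => ContinuousAlternatingMap.curryLeft (E := E) (ϖ.1 x) u)

/-- The space `Ω¹_Ham(M)` of Hamiltonian 1-forms: those `α` for which there is a vector field `X`
with `dα = -ι_X ϖ`. -/
def hamForms (ϖ : Form E M 3) : Submodule ℝ (Form E M 1) where
  carrier := {α | ∃ X : VectorFld E M, Form.d α = -Form.contract X ϖ}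
  add_mem' := by
    rintro α β ⟨X, hX⟩ ⟨Y, hY⟩
    exact ⟨X + Y, by rw [map_add, hX, hY, map_add, LinearMap.add_apply, neg_add]⟩
  zero_mem' := ⟨0, by simp⟩
  smul_mem' := by
    rintro c α ⟨X, hX⟩
    exact ⟨c • X, by rw [map_smul, hX, map_smul, LinearMap.smul_apply, smul_neg]⟩

/-- A Hamiltonian vector field `v_α` of a Hamiltonian 1-form `α`; it is unique when `ϖ` is
2-plectic. -/
def hamVF {ϖ : Form E M 3} (α : hamForms ϖ) : VectorFld E M := α.2.choose

theorem d_eq_neg_contract_hamVF {ϖ : Form E M 3} (α : hamForms ϖ) :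
    Form.d α.1 = -Form.contract (hamVF α) ϖ := α.2.choose_spec

/-- The binary bracket `[α, β]' = ι_{v_β} ι_{v_α} ϖ` of `L_∞(M, ϖ)` on Hamiltonian 1-forms. (All
brackets of arity at least two vanish as soon as one entry is a function.) -/
def bracket₂ {ϖ : Form E M 3} (α β : hamForms ϖ) : Form E M 1 :=
  Form.contract (hamVF β) (Form.contract (hamVF α) ϖ)

/-- The trinary bracket `[α, β, γ]' = -ι_{v_γ} ι_{v_β} ι_{v_α} ϖ` of `L_∞(M, ϖ)` on Hamiltonian
1-forms. -/
def bracket₃ {ϖ : Form E M 3} (α β γ : hamForms ϖ) : Form E M 0 :=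
  -Form.contract (hamVF γ) (Form.contract (hamVF β) (Form.contract (hamVF α) ϖ))

/-- `v` is an infinitesimal action by Hamiltonian vector fields: a Lie algebra morphism
`𝔤 → 𝔛(M)` such that every `v x` is the Hamiltonian vector field of some 1-form. -/
def IsHamiltonianAction {𝔤 : Type*} [LieRing 𝔤] [LieAlgebra ℝ 𝔤] (ϖ : Form E M 3)
    (v : 𝔤 →ₗ[ℝ] VectorFld E M) : Prop :=
  (∀ (x y : 𝔤) (p : M), v ⁅x, y⁆ p = VectorField.mlieBracket 𝓘(ℝ, E) (v x) (v y) p) ∧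
    ∀ x : 𝔤, ∃ α : Form E M 1, Form.d α = -Form.contract (v x) ϖ

variable {𝔤 𝔥 : Type*} [LieRing 𝔤] [LieAlgebra ℝ 𝔤] [AddCommGroup 𝔥] [Module ℝ 𝔥]

/-- An `L_∞`-morphism `(f₁, f₂)` from the minimal Lie 2-algebra `𝔥[1] ⊕ 𝔤` to the Lie 2-algebra
`L_∞(M, ϖ)`, whose degree 0 part is `Ω¹_Ham(M)`, whose degree `-1` part is `C^∞(M) = Ω⁰(M)`, and
whose unary bracket is the de Rham differential. The components are `f₁|𝔤`, `f₁|𝔥`, `f₂`, and the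
equations are those of a morphism of Lie 2-algebras (the unary bracket of the source is zero). In
the third equation the bracket `[h, x]` is `-[x, h]`. -/
structure LInftyMorphism (L : MinimalLieTwoAlgebra 𝔤 𝔥) (ϖ : Form E M 3) where
  f₁g : 𝔤 →ₗ[ℝ] hamForms ϖ
  f₁h : 𝔥 →ₗ[ℝ] Form E M 0
  f₂ : 𝔤 [⋀^Fin 2]→ₗ[ℝ] Form E M 0
  d_f₁h : ∀ h : 𝔥, Form.d (f₁h h) = 0
  d_f₂ : ∀ x y : 𝔤, Form.d (f₂ ![x, y]) = (f₁g ⁅x, y⁆).1 - bracket₂ (f₁g x) (f₁g y)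
  f₁h_bracket : ∀ (h : 𝔥) (x : 𝔤), 0 = f₁h (-L.act x h)
  f₁h_trinary : ∀ x y z : 𝔤,
    f₁h (L.trinary ![x, y, z]) - bracket₃ (f₁g x) (f₁g y) (f₁g z) =
      f₂ ![x, ⁅y, z⁆] - f₂ ![y, ⁅x, z⁆] + f₂ ![z, ⁅x, y⁆]

/-- A homotopy moment map for `𝔥[1] ⊕ 𝔤`: an `L_∞`-morphism to `L_∞(M, ϖ)` such that
`-ι_{v_x} ϖ = d (f₁ x)` for all `x` in `𝔤`. -/
structure MomentMap (L : MinimalLieTwoAlgebra 𝔤 𝔥) (ϖ : Form E M 3)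
    (v : 𝔤 →ₗ[ℝ] VectorFld E M) extends LInftyMorphism L ϖ where
  moment : ∀ x : 𝔤, -Form.contract (v x) ϖ = Form.d (f₁g x).1

/-- Triples of linear maps `𝔤 → Ω¹(M)`, `𝔥 → C^∞(M)`, `⋀² 𝔤 → C^∞(M)`. -/
abbrev ComponentSpace (𝔤 𝔥 : Type*) [LieRing 𝔤] [LieAlgebra ℝ 𝔤] [AddCommGroup 𝔥] [Module ℝ 𝔥]
    (E : Type*) [NormedAddCommGroup E] [NormedSpace ℝ E]
    (M : Type*) [TopologicalSpace M] [ChartedSpace E M] : Type _ :=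
  (𝔤 →ₗ[ℝ] Form E M 1) × (𝔥 →ₗ[ℝ] Form E M 0) × (𝔤 [⋀^Fin 2]→ₗ[ℝ] Form E M 0)

/-- The triple `(f₁|𝔤, f₁|𝔥, f₂)` of a moment map. -/
def MomentMap.components {L : MinimalLieTwoAlgebra 𝔤 𝔥} {ϖ : Form E M 3}
    {v : 𝔤 →ₗ[ℝ] VectorFld E M} (φ : MomentMap L ϖ v) : ComponentSpace 𝔤 𝔥 E M :=
  ((hamForms ϖ).subtype ∘ₗ φ.f₁g, φ.f₁h, φ.f₂)

end Multisymplectic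

section Contractions
variable {𝔤 𝔥 : Type*} [LieRing 𝔤] [LieAlgebra ℝ 𝔤]
  {E : Type*} [NormedAddCommGroup E] [NormedSpace ℝ E] [FiniteDimensional ℝ E]
  {M : Type*} [TopologicalSpace M] [ChartedSpace E M] [IsManifold 𝓘(ℝ, E) ∞ M]

/-- For a word `x₁ … x_k` of elements of `𝔤`, the map `α ↦ ι_{v_{x_k}} … ι_{v_{x₁}} α`; zero on
all other words. -/
def contractWord (v : 𝔤 →ₗ[ℝ] VectorFld E M) :
    (k m : ℕ) → List (𝔥 ⊕ 𝔤) → Form E M (m + k) →ₗ[ℝ] Form E M m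
  | 0, _, [] => LinearMap.id
  | 0, _, _ :: _ => 0
  | _ + 1, _, [] => 0
  | _ + 1, _, Sum.inl _ :: _ => 0
  | k + 1, m, Sum.inr x :: t => contractWord v k m t ∘ₗ Form.contract (v x)

theorem contract_anticomm {k : ℕ} (X Y : VectorFld E M) (α : Form E M (k + 2)) :
    Form.contract Y (Form.contract X α) = -Form.contract X (Form.contract Y α) := by
  have key : ∀ (η : E [⋀^Fin (k + 2)]→L[ℝ] ℝ) (a b : E),
      (η.curryLeft a).curryLeft b = -(η.curryLeft b).curryLeft a := by
    intro η a b
    ext m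
    change η (Fin.cons a (Fin.cons b m)) = -η (Fin.cons b (Fin.cons a m))
    refine Eq.trans ?_ (η.toAlternatingMap.map_swap (Fin.cons b (Fin.cons a m))
      (show (0 : Fin (k + 2)) ≠ 1 by simp))
    change η _ = η _
    congr 1
    funext i
    refine Fin.cases ?_ (fun j => Fin.cases ?_ (fun l => ?_) j) i
    · rw [Function.comp_apply, Equiv.swap_apply_left]
      rfl
    · have : (Fin.succ 0 : Fin (k + 2)) = 1 := rfl
      rw [Function.comp_apply, this, Equiv.swap_apply_right]
      rfl
    · rw [Function.comp_apply, Equiv.swap_apply_of_ne_of_ne (Fin.succ_ne_zero _)]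
      · rfl
      · intro h
        exact Fin.succ_ne_zero l (Fin.succ_injective _ h)
  exact Subtype.ext (funext fun x => key (α.1 x) (X x) (Y x))

theorem contractWord_wt (v : 𝔤 →ₗ[ℝ] VectorFld E M) (k m : ℕ) (w : List (𝔥 ⊕ 𝔤))
    (h : wordWt w ≠ k) : contractWord v k m w = 0 := by
  induction w generalizing k with
  | nil =>
    cases k with
    | zero => exact absurd rfl h
    | succ k => rfl
  | cons a w ih =>
    rcases k with _ | k <;> rcases a with a | a
    · rfl
    · rfl
    · rfl
    · rw [contractWord, ih k, LinearMap.zero_comp]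
      rw [wordWt_cons, wt] at h
      omega

end Contractions

section TotalComplex
variable {𝔤 𝔥 : Type*} [LieRing 𝔤] [LieAlgebra ℝ 𝔤] [AddCommGroup 𝔥] [Module ℝ 𝔥]
  {E : Type*} [NormedAddCommGroup E] [NormedSpace ℝ E]
  {M : Type*} [TopologicalSpace M] [ChartedSpace E M]

/-- The (graded) vector space `C = CE(L) ⊗ Ω(M)`, the direct sum over all bidegrees `(p, q)` of
`CE(L)^p ⊗ Ω^q(M)`. -/
abbrev TotalSpace (𝔤 𝔥 : Type*) [LieRing 𝔤] [LieAlgebra ℝ 𝔤] [AddCommGroup 𝔥] [Module ℝ 𝔥]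
    (E : Type*) [NormedAddCommGroup E] [NormedSpace ℝ E]
    (M : Type*) [TopologicalSpace M] [ChartedSpace E M] : Type _ :=
  DirectSum (ℕ × ℕ) fun pq => Cochain 𝔤 𝔥 pq.1 ℝ ⊗[ℝ] Form E M pq.2

instance TotalSpace.instAddCommGroup : AddCommGroup (TotalSpace 𝔤 𝔥 E M) :=
  @DirectSum.instAddCommGroup (ℕ × ℕ) (fun pq => Cochain 𝔤 𝔥 pq.1 ℝ ⊗[ℝ] Form E M pq.2)
    (fun _ => TensorProduct.addCommGroup)

/-- The inclusion of the summand of bidegree `(p, q)`. -/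
abbrev TotalSpace.incl (𝔤 𝔥 : Type*) [LieRing 𝔤] [LieAlgebra ℝ 𝔤] [AddCommGroup 𝔥] [Module ℝ 𝔥]
    (E : Type*) [NormedAddCommGroup E] [NormedSpace ℝ E]
    (M : Type*) [TopologicalSpace M] [ChartedSpace E M] (p q : ℕ) :
    Cochain 𝔤 𝔥 p ℝ ⊗[ℝ] Form E M q →ₗ[ℝ] TotalSpace 𝔤 𝔥 E M :=
  DirectSum.lof ℝ (ℕ × ℕ) (fun pq => Cochain 𝔤 𝔥 pq.1 ℝ ⊗[ℝ] Form E M pq.2) (p, q)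

/-- The subspace `C^n` of elements of total degree `n`. -/
def totalDegree (𝔤 𝔥 : Type*) [LieRing 𝔤] [LieAlgebra ℝ 𝔤] [AddCommGroup 𝔥] [Module ℝ 𝔥]
    (E : Type*) [NormedAddCommGroup E] [NormedSpace ℝ E]
    (M : Type*) [TopologicalSpace M] [ChartedSpace E M] (n : ℕ) :
    Submodule ℝ (TotalSpace 𝔤 𝔥 E M) where
  carrier := {μ | ∀ pq : ℕ × ℕ, pq.1 + pq.2 ≠ n → μ pq = 0}
  add_mem' := fun {μ ν} hμ hν pq h => by rw [DirectSum.add_apply, hμ pq h, hν pq h, add_zero]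
  zero_mem' := fun _ _ => rfl
  smul_mem' := fun c μ hμ pq h => by rw [DirectSum.smul_apply, hμ pq h, smul_zero]

/-- The component map `C → CE(L)^p ⊗ Ω^q(M) ≃ {cochains of degree p with values in Ω^q(M)}`. -/
def bidegreeComponent [FiniteDimensional ℝ 𝔤] [FiniteDimensional ℝ 𝔥] (p q : ℕ) :
    TotalSpace 𝔤 𝔥 E M →ₗ[ℝ] Cochain 𝔤 𝔥 p (Form E M q) :=
  (tensorEquiv p).toLinearMap ∘ₗ
    DirectSum.component ℝ (ℕ × ℕ) (fun pq => Cochain 𝔤 𝔥 pq.1 ℝ ⊗[ℝ] Form E M pq.2) (p, q)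

/-- The components `μ₁|𝔤 : 𝔤 → Ω¹(M)`, `μ₁|𝔥 : 𝔥 → C^∞(M)` and `μ₂ : ⋀² 𝔤 → C^∞(M)` of an
element of `C² = 𝔤[1]^* ⊗ Ω¹(M) ⊕ (𝔥[2]^* ⊕ S²(𝔤[1])^*) ⊗ C^∞(M)`. -/
def degreeTwoComponents [FiniteDimensional ℝ 𝔤] [FiniteDimensional ℝ 𝔥] :
    TotalSpace 𝔤 𝔥 E M →ₗ[ℝ] ComponentSpace 𝔤 𝔥 E M :=
  (Cochain.onG ∘ₗ bidegreeComponent 1 1).prod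
    ((Cochain.onH ∘ₗ bidegreeComponent 2 0).prod (Cochain.onGG ∘ₗ bidegreeComponent 2 0))

variable [IsManifold 𝓘(ℝ, E) ∞ M]

/-- The total differential `d_tot = d_CE ⊗ 1 + 1 ⊗ d_dR`. As usual for tensor products of
complexes, `(1 ⊗ d_dR)(ξ ⊗ α) = (-1)^p ξ ⊗ dα` for `ξ` of degree `p`. -/
def dTot (L : MinimalLieTwoAlgebra 𝔤 𝔥) : TotalSpace 𝔤 𝔥 E M →ₗ[ℝ] TotalSpace 𝔤 𝔥 E M :=
  DirectSum.toModule ℝ (ℕ × ℕ) (TotalSpace 𝔤 𝔥 E M) fun pq =>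
    TotalSpace.incl 𝔤 𝔥 E M (pq.1 + 1) pq.2 ∘ₗ (ceD L pq.1).rTensor (Form E M pq.2) +
      (-1 : ℝ) ^ pq.1 • (TotalSpace.incl 𝔤 𝔥 E M pq.1 (pq.2 + 1) ∘ₗ
        (Form.d : Form E M pq.2 →ₗ[ℝ] Form E M (pq.2 + 1)).lTensor (Cochain 𝔤 𝔥 pq.1 ℝ))

variable [FiniteDimensional ℝ E]

theorem isGradedSymm_contractWord (v : 𝔤 →ₗ[ℝ] VectorFld E M) (k m : ℕ) (ϖ : Form E M (m + k)) :
    IsGradedSymm (fun w : List (𝔥 ⊕ 𝔤) => contractWord v k m w ϖ) := by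
  refine ⟨fun u t c h h' => ?_, fun u t c x x' => ?_, fun u t a b => ?_⟩
  · induction u generalizing k with
    | nil => rcases k with _ | k <;> simp [contractWord]
    | cons e u ih =>
      rcases k with _ | k <;> rcases e with e | e
      · simp [contractWord]
      · simp [contractWord]
      · simp [contractWord]
      · exact ih k (Form.contract (v e) ϖ)
  · induction u generalizing k with
    | nil => rcases k with _ | k <;> simp [contractWord]
    | cons e u ih =>
      rcases k with _ | k <;> rcases e with e | e
      · simp [contractWord]
      · simp [contractWord]
      · simp [contractWord]
      · exact ih k (Form.contract (v e) ϖ)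
  · induction u generalizing k with
    | nil =>
      rcases k with _ | _ | k <;> rcases a with a | a <;> rcases b with b | b
      on_goal 12 =>
        change contractWord v k m t (Form.contract (v b) (Form.contract (v a) ϖ)) =
          (-1 : ℝ) ^ (1 * 1) • contractWord v k m t (Form.contract (v a) (Form.contract (v b) ϖ))
        rw [contract_anticomm (v a) (v b) ϖ, map_neg]
        simp
      all_goals simp [contractWord]
    | cons e u ih =>
      rcases k with _ | k <;> rcases e with e | e
      · simp [contractWord]
      · simp [contractWord]
      · simp [contractWord]
      · exact ih k (Form.contract (v e) ϖ)

/-- `ϖ_k : ⋀^k 𝔤 → Ω^m(M)`, `(x₁, …, x_k) ↦ ι_{v_{x_k}} … ι_{v_{x₁}} ϖ`, for an `(m + k)`-form `ϖ`,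
seen as a cochain of degree `k` through `⋀ 𝔤^* ≅ S(𝔤[1])^* ⊆ S(𝔥[2] ⊕ 𝔤[1])^*`. The number `k ≥ 1`
is written as `j + 1`. -/
def contractionCochain (𝔥 : Type*) [AddCommGroup 𝔥] [Module ℝ 𝔥] (v : 𝔤 →ₗ[ℝ] VectorFld E M)
    (j m : ℕ) (ϖ : Form E M (m + (j + 1))) : Cochain 𝔤 𝔥 (j + 1) (Form E M m) :=
  ⟨fun w => contractWord v (j + 1) m w ϖ, isGradedSymm_contractWord v (j + 1) m ϖ, rfl,
    fun w hw => by
      change contractWord v (j + 1) m w ϖ = 0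
      rw [contractWord_wt v (j + 1) m w hw, LinearMap.zero_apply]⟩

/-- The element `ϖ̃ = ϖ₁ - ϖ₂ + ϖ₃` of `C³`, where `ϖ_k` lies in `CE(L)^k ⊗ Ω^{3-k}(M)`. -/
def omegaTilde [FiniteDimensional ℝ 𝔤] (𝔥 : Type*) [AddCommGroup 𝔥] [Module ℝ 𝔥]
    [FiniteDimensional ℝ 𝔥] (ϖ : Form E M 3) (v : 𝔤 →ₗ[ℝ] VectorFld E M) : TotalSpace 𝔤 𝔥 E M :=
  TotalSpace.incl 𝔤 𝔥 E M 1 2 ((tensorEquiv 1).symm (contractionCochain 𝔥 v 0 2 ϖ)) -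
    TotalSpace.incl 𝔤 𝔥 E M 2 1 ((tensorEquiv 2).symm (contractionCochain 𝔥 v 1 1 ϖ)) +
    TotalSpace.incl 𝔤 𝔥 E M 3 0 ((tensorEquiv 3).symm (contractionCochain 𝔥 v 2 0 ϖ))

end TotalComplex

end

/-!
The two sides of the correspondence are the same system of equations. An element `μ` of degree two
lives in bidegrees `(1, 1)` and `(2, 0)`, because `CE(L)` has nothing in degree zero. A cochain of
degree one is a linear map on `𝔤`, and a cochain of degree two is a linear map on `𝔥` together with
an alternating map on `𝔤`: these are the only values on words of weight one and two that graded
symmetry leaves free. Hence `μ` is the same as its three components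
(`bijective_degreeTwoComponents`).

Both `d_tot μ` and `ϖ̃` live in bidegrees `(1, 2)`, `(2, 1)` and `(3, 0)`, and the identifications
`tensorEval` turn `d_CE ⊗ 1` and `1 ⊗ d_dR` into the Chevalley–Eilenberg differential of cochains
with values in forms and postcomposition with `d`, so `d_tot μ = ϖ̃` becomes three equations between
such cochains (`dTot_eq_omegaTilde_iff`). Evaluating them on words of weight one, two and three gives
five equations for the components (`dTot_eq_omegaTilde_iff_isMomentTriple`).

These are the equations of a moment map with `v x` in place of the Hamiltonian vector field of
`f₁ x`; the two vector fields agree since `ϖ` is nondegenerate (`exists_components_eq_iff`).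
Finally, the image under the linear map `degreeTwoComponents` of the solutions of the affine equation
`d_tot μ = ϖ̃` is an affine subspace (`exists_affineSubspace_of_linear_equation`).
-/

/-! ### Cochains of low degree -/

section Unshuffles
variable {𝔤 𝔥 W : Type*} [AddCommGroup W] [Module ℝ W]

theorem unshuffleSum_smul_const (k : ℕ) (F : List (𝔥 ⊕ 𝔤) → List (𝔥 ⊕ 𝔤) → ℝ) (m : W)
    (w : List (𝔥 ⊕ 𝔤)) :
    unshuffleSum k (fun u r => F u r • m) w = unshuffleSum k F w • m := by
  simp only [unshuffleSum, List.sum_smul, List.map_map, smul_eq_mul, ← mul_smul]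
  rfl

end Unshuffles

section Cochains
variable {𝔤 𝔥 : Type*} [LieRing 𝔤] [LieAlgebra ℝ 𝔤] [AddCommGroup 𝔥] [Module ℝ 𝔥]
  {W : Type*} [AddCommGroup W] [Module ℝ W]

theorem Cochain.ext_of_wordWt {p : ℕ} {ξ η : Cochain 𝔤 𝔥 p W}
    (h : ∀ w, wordWt w = p → ξ.1 w = η.1 w) : ξ = η := by
  apply Subtype.ext
  funext w
  by_cases hw : wordWt w = p
  · exact h w hw
  · rw [ξ.2.2.2 w hw, η.2.2.2 w hw]

theorem Cochain.eq_zero_of_degree_zero (ξ : Cochain 𝔤 𝔥 0 W) : ξ = 0 := by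
  refine Cochain.ext_of_wordWt fun w hw => ?_
  rcases w with _ | ⟨a | a, w⟩
  · exact ξ.2.2.1
  all_goals exfalso; simp only [wordWt_cons, wt] at hw; omega

theorem Cochain.ext_one {ξ η : Cochain 𝔤 𝔥 1 W}
    (h : ∀ x : 𝔤, ξ.1 [Sum.inr x] = η.1 [Sum.inr x]) : ξ = η := by
  refine Cochain.ext_of_wordWt fun w hw => ?_
  rcases w with _ | ⟨a | a, _ | ⟨b | b, w⟩⟩
  case cons.inr.nil => exact h a
  all_goals
    exfalso
    simp only [wordWt, wt, List.map_cons, List.sum_cons, List.map_nil, List.sum_nil] at hw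
    omega

theorem Cochain.ext_two {ξ η : Cochain 𝔤 𝔥 2 W}
    (h₁ : ∀ h : 𝔥, ξ.1 [Sum.inl h] = η.1 [Sum.inl h])
    (h₂ : ∀ x y : 𝔤, ξ.1 [Sum.inr x, Sum.inr y] = η.1 [Sum.inr x, Sum.inr y]) : ξ = η := by
  refine Cochain.ext_of_wordWt fun w hw => ?_
  rcases w with _ | ⟨a | a, _ | ⟨b | b, _ | ⟨c | c, w⟩⟩⟩
  case cons.inl.nil => exact h₁ a
  case cons.inr.cons.inr.nil => exact h₂ a b
  all_goals
    exfalso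
    simp only [wordWt, wt, List.map_cons, List.sum_cons, List.map_nil, List.sum_nil] at hw
    omega

/-- A word of weight three consists of three letters in `𝔤`, or of one letter in `𝔤` and one in `𝔥`;
by graded symmetry the order of the latter two does not matter. -/
theorem Cochain.ext_three {ξ η : Cochain 𝔤 𝔥 3 W}
    (h₁ : ∀ (x : 𝔤) (h : 𝔥), ξ.1 [Sum.inr x, Sum.inl h] = η.1 [Sum.inr x, Sum.inl h])
    (h₂ : ∀ x y z : 𝔤, ξ.1 [Sum.inr x, Sum.inr y, Sum.inr z] =
      η.1 [Sum.inr x, Sum.inr y, Sum.inr z]) : ξ = η := by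
  refine Cochain.ext_of_wordWt fun w hw => ?_
  rcases w with _ | ⟨a | a, _ | ⟨b | b, _ | ⟨c | c, _ | ⟨d | d, w⟩⟩⟩⟩
  case cons.inl.cons.inr.nil =>
    have hξ := ξ.2.1.swap [] [] (Sum.inl a) (Sum.inr b)
    have hη := η.2.1.swap [] [] (Sum.inl a) (Sum.inr b)
    simp only [List.nil_append] at hξ hη
    rw [hξ, hη, h₁]
  case cons.inr.cons.inl.nil => exact h₁ a b
  case cons.inr.cons.inr.cons.inr.nil => exact h₂ a b c
  all_goals
    exfalso
    simp only [wordWt, wt, List.map_cons, List.sum_cons, List.map_nil, List.sum_nil] at hw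
    omega

/-- The cochain of degree one with given values on `𝔤`. -/
noncomputable def Cochain.ofG (f : 𝔤 →ₗ[ℝ] W) : Cochain 𝔤 𝔥 1 W :=
  ⟨fun w => match w with
    | [Sum.inr x] => f x
    | _ => 0, by
    refine ⟨⟨fun u t c h h' => ?_, fun u t c x x' => ?_, fun u t a b => ?_⟩, rfl, fun w hw => ?_⟩
    · rcases u with _ | ⟨a | a, _ | ⟨b, u⟩⟩ <;> simp
    · rcases u with _ | ⟨a | a, _ | ⟨b, u⟩⟩ <;> rcases t with _ | ⟨d, t⟩ <;> simp
    · rcases u with _ | ⟨e | e, _ | ⟨f, u⟩⟩ <;> simp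
    · dsimp only
      split
      · simp [wordWt, wt] at hw
      · rfl⟩

/-- The cochain of degree two with given values on `𝔥` and on `⋀² 𝔤`. -/
noncomputable def Cochain.ofHGG (g : 𝔥 →ₗ[ℝ] W) (f : 𝔤 [⋀^Fin 2]→ₗ[ℝ] W) : Cochain 𝔤 𝔥 2 W :=
  ⟨fun w => match w with
    | [Sum.inl h] => g h
    | [Sum.inr x, Sum.inr y] => f ![x, y]
    | _ => 0, by
    have l₀ : ∀ (c : ℝ) (x x' y : 𝔤), f ![c • x + x', y] = c • f ![x, y] + f ![x', y] :=
      fun c x x' y => by rw [f.map_vecCons_add, f.map_vecCons_smul]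
    have s : ∀ x y : 𝔤, f ![y, x] = -f ![x, y] := fun x y => by
      rw [← f.map_swap ![x, y] (show (0 : Fin 2) ≠ 1 by decide)]
      congr 1; ext i; fin_cases i <;> rfl
    have l₁ : ∀ (c : ℝ) (x x' y : 𝔤), f ![y, c • x + x'] = c • f ![y, x] + f ![y, x'] :=
      fun c x x' y => by
        rw [s _ y, l₀, s y x, s y x', smul_neg, neg_add, neg_neg, neg_neg]
    refine ⟨⟨fun u t c h h' => ?_, fun u t c x x' => ?_, fun u t a b => ?_⟩, rfl, fun w hw => ?_⟩
    · rcases u with _ | ⟨a | a, _ | ⟨b | b, u⟩⟩ <;> rcases t with _ | ⟨d | d, t⟩ <;> simp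
    · rcases u with _ | ⟨a | a, _ | ⟨b | b, u⟩⟩ <;> rcases t with _ | ⟨d | d, _ | ⟨e, t⟩⟩ <;>
        simp [l₀, l₁]
    · rcases u with _ | ⟨e | e, _ | ⟨j | j, u⟩⟩ <;> rcases a with a | a <;> rcases b with b | b <;>
        rcases t with _ | ⟨d | d, t⟩ <;>
        simp [wt, ← s]
    · dsimp only
      split
      · simp [wordWt, wt] at hw
      · simp [wordWt, wt] at hw
      · rfl⟩

/-! ### The Chevalley–Eilenberg differential on words of low weight -/

theorem ceD_apply (L : MinimalLieTwoAlgebra 𝔤 𝔥) (p : ℕ) (ξ : Cochain 𝔤 𝔥 p W)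
    (w : List (𝔥 ⊕ 𝔤)) :
    (ceD L p ξ).1 w = -unshuffleSum 2 (fun u r => ξ.1 (L.l₂ u :: r)) w +
      unshuffleSum 3 (fun u r => ξ.1 (L.l₃ u :: r)) w := rfl

theorem ceD_inl (L : MinimalLieTwoAlgebra 𝔤 𝔥) (ξ : Cochain 𝔤 𝔥 1 W) (h : 𝔥) :
    (ceD L 1 ξ).1 [Sum.inl h] = 0 := by
  simp [ceD_apply, unshuffleSum, unshuffles]

theorem ceD_inr_inr (L : MinimalLieTwoAlgebra 𝔤 𝔥) (ξ : Cochain 𝔤 𝔥 1 W) (x y : 𝔤) :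
    (ceD L 1 ξ).1 [Sum.inr x, Sum.inr y] = -ξ.1 [Sum.inr ⁅x, y⁆] := by
  simp [ceD_apply, unshuffleSum, unshuffles, MinimalLieTwoAlgebra.l₂]

theorem ceD_inr_inl (L : MinimalLieTwoAlgebra 𝔤 𝔥) (ξ : Cochain 𝔤 𝔥 2 W) (x : 𝔤) (h : 𝔥) :
    (ceD L 2 ξ).1 [Sum.inr x, Sum.inl h] = -ξ.1 [Sum.inl (L.act x h)] := by
  simp [ceD_apply, unshuffleSum, unshuffles, MinimalLieTwoAlgebra.l₂]

theorem ceD_inr_inr_inr (L : MinimalLieTwoAlgebra 𝔤 𝔥) (ξ : Cochain 𝔤 𝔥 2 W) (x y z : 𝔤) :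
    (ceD L 2 ξ).1 [Sum.inr x, Sum.inr y, Sum.inr z] =
      ξ.1 [Sum.inr x, Sum.inr ⁅y, z⁆] - ξ.1 [Sum.inr y, Sum.inr ⁅x, z⁆] +
        ξ.1 [Sum.inr z, Sum.inr ⁅x, y⁆] - ξ.1 [Sum.inl (L.trinary ![x, y, z])] := by
  have s : ∀ a b : 𝔤, ξ.1 [Sum.inr a, Sum.inr b] = -ξ.1 [Sum.inr b, Sum.inr a] := fun a b => by
    simpa [wt] using ξ.2.1.swap [] [] (Sum.inr a) (Sum.inr b)
  simp only [ceD_apply, unshuffleSum, unshuffles, MinimalLieTwoAlgebra.l₂,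
    MinimalLieTwoAlgebra.l₃, wordWt, wt, List.map_nil, List.map_cons, List.sum_nil, List.sum_cons,
    List.append_nil, List.nil_append, List.cons_append, ξ.2.1.inl_neg]
  -- The unshuffles put the bracket into the first slot; `s` moves it into the second one.
  rw [s x, s y, s z]
  norm_num
  abel

theorem tensorEval_rTensor_ceD (L : MinimalLieTwoAlgebra 𝔤 𝔥) (p : ℕ)
    (t : Cochain 𝔤 𝔥 p ℝ ⊗[ℝ] W) :
    tensorEval (p + 1) ((ceD L p).rTensor W t) = ceD L p (tensorEval p t) := by
  induction t with
  | zero => simp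
  | add t t' ht ht' => simp [ht, ht']
  | tmul ξ m =>
    apply Subtype.ext
    funext w
    simp only [LinearMap.rTensor_tmul, tensorEval_tmul, ceD_apply, unshuffleSum_smul_const,
      neg_smul, add_smul]

theorem tensorEval_lTensor {W' : Type*} [AddCommGroup W'] [Module ℝ W'] (f : W →ₗ[ℝ] W') (p : ℕ)
    (t : Cochain 𝔤 𝔥 p ℝ ⊗[ℝ] W) (w : List (𝔥 ⊕ 𝔤)) :
    (tensorEval p (f.lTensor (Cochain 𝔤 𝔥 p ℝ) t)).1 w = f ((tensorEval p t).1 w) := by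
  induction t with
  | zero => simp
  | add t t' ht ht' => simp [ht, ht']
  | tmul ξ m => simp [tensorEval_tmul]

end Cochains

/-! ### Elements of total degree two -/

section TotalDegreeTwo
variable {𝔤 𝔥 : Type*} [LieRing 𝔤] [LieAlgebra ℝ 𝔤] [AddCommGroup 𝔥] [Module ℝ 𝔥]
  {E : Type*} [NormedAddCommGroup E] [NormedSpace ℝ E]
  {M : Type*} [TopologicalSpace M] [ChartedSpace E M]

theorem eq_zero_of_cochain_degree_zero {q : ℕ} (t : Cochain 𝔤 𝔥 0 ℝ ⊗[ℝ] Form E M q) : t = 0 := by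
  apply tensorEval_injective 0
  rw [map_zero]
  exact Cochain.eq_zero_of_degree_zero _

/-- The sign is written as the scalar `-1`, so that linearity over `ℝ` alone moves it through the
tensor product. -/
theorem incl_neg_one_smul {p q : ℕ} (t : Cochain 𝔤 𝔥 p ℝ ⊗[ℝ] Form E M q) :
    TotalSpace.incl 𝔤 𝔥 E M p q ((-1 : ℝ) • t) = -TotalSpace.incl 𝔤 𝔥 E M p q t := by
  refine (LinearMap.map_smul _ _ _).trans ?_
  exact neg_one_smul ℝ (TotalSpace.incl 𝔤 𝔥 E M p q t)

/-- There is no summand `CE(L)^0 ⊗ Ω²(M)` since `CE(L)` only contains symmetric powers of positive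
order. -/
theorem mem_totalDegree_two_iff {μ : TotalSpace 𝔤 𝔥 E M} :
    μ ∈ totalDegree 𝔤 𝔥 E M 2 ↔
      μ = TotalSpace.incl 𝔤 𝔥 E M 1 1 (μ (1, 1)) + TotalSpace.incl 𝔤 𝔥 E M 2 0 (μ (2, 0)) := by
  constructor
  · intro h
    refine DFinsupp.ext fun pq => ?_
    rw [DirectSum.add_apply]
    by_cases h₁ : pq = (1, 1)
    · subst h₁
      rw [DirectSum.lof_apply, DirectSum.lof_eq_of,
        DirectSum.of_eq_of_ne _ _ _ (by simp), add_zero]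
    by_cases h₂ : pq = (2, 0)
    · subst h₂
      rw [DirectSum.lof_apply, DirectSum.lof_eq_of,
        DirectSum.of_eq_of_ne _ _ _ (by simp), zero_add]
    rw [DirectSum.lof_eq_of, DirectSum.lof_eq_of,
      DirectSum.of_eq_of_ne _ _ _ h₁, DirectSum.of_eq_of_ne _ _ _ h₂, add_zero]
    obtain ⟨p, q⟩ := pq
    by_cases h₃ : p = 0
    · subst h₃
      exact eq_zero_of_cochain_degree_zero _
    · apply h
      simp only [Prod.mk.injEq, ne_eq] at h₁ h₂ ⊢
      omega
  · intro h pq hpq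
    rw [h, DirectSum.add_apply, DirectSum.lof_eq_of, DirectSum.lof_eq_of,
      DirectSum.of_eq_of_ne, DirectSum.of_eq_of_ne, add_zero]
    all_goals
      rintro rfl
      exact hpq rfl

theorem incl_add_incl_apply (a : Cochain 𝔤 𝔥 1 ℝ ⊗[ℝ] Form E M 1)
    (b : Cochain 𝔤 𝔥 2 ℝ ⊗[ℝ] Form E M 0) :
    (TotalSpace.incl 𝔤 𝔥 E M 1 1 a + TotalSpace.incl 𝔤 𝔥 E M 2 0 b : TotalSpace 𝔤 𝔥 E M) (1, 1) =
        a ∧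
      (TotalSpace.incl 𝔤 𝔥 E M 1 1 a + TotalSpace.incl 𝔤 𝔥 E M 2 0 b : TotalSpace 𝔤 𝔥 E M) (2, 0) =
        b := by
  constructor
  · rw [DirectSum.add_apply, DirectSum.lof_apply, DirectSum.lof_eq_of,
      DirectSum.of_eq_of_ne _ _ _ (by simp), add_zero]
  · rw [DirectSum.add_apply, DirectSum.lof_apply, DirectSum.lof_eq_of,
      DirectSum.of_eq_of_ne _ _ _ (by simp), zero_add]

theorem incl_degree_three_inj {a a' : Cochain 𝔤 𝔥 1 ℝ ⊗[ℝ] Form E M 2}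
    {b b' : Cochain 𝔤 𝔥 2 ℝ ⊗[ℝ] Form E M 1} {c c' : Cochain 𝔤 𝔥 3 ℝ ⊗[ℝ] Form E M 0} :
    TotalSpace.incl 𝔤 𝔥 E M 1 2 a + TotalSpace.incl 𝔤 𝔥 E M 2 1 b + TotalSpace.incl 𝔤 𝔥 E M 3 0 c =
      TotalSpace.incl 𝔤 𝔥 E M 1 2 a' + TotalSpace.incl 𝔤 𝔥 E M 2 1 b' +
        TotalSpace.incl 𝔤 𝔥 E M 3 0 c' ↔ a = a' ∧ b = b' ∧ c = c' := by
  have ev : ∀ (a : Cochain 𝔤 𝔥 1 ℝ ⊗[ℝ] Form E M 2) (b : Cochain 𝔤 𝔥 2 ℝ ⊗[ℝ] Form E M 1)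
      (c : Cochain 𝔤 𝔥 3 ℝ ⊗[ℝ] Form E M 0) (μ : TotalSpace 𝔤 𝔥 E M),
      μ = TotalSpace.incl 𝔤 𝔥 E M 1 2 a + TotalSpace.incl 𝔤 𝔥 E M 2 1 b +
        TotalSpace.incl 𝔤 𝔥 E M 3 0 c → μ (1, 2) = a ∧ μ (2, 1) = b ∧ μ (3, 0) = c := by
    rintro a b c _ rfl
    simp only [DirectSum.add_apply]
    refine ⟨?_, ?_, ?_⟩
    · rw [DirectSum.lof_apply, DirectSum.lof_eq_of, DirectSum.lof_eq_of,
        DirectSum.of_eq_of_ne _ _ _ (by simp), DirectSum.of_eq_of_ne _ _ _ (by simp), add_zero,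
        add_zero]
    · rw [DirectSum.lof_apply, DirectSum.lof_eq_of, DirectSum.lof_eq_of,
        DirectSum.of_eq_of_ne _ _ _ (by simp), DirectSum.of_eq_of_ne _ _ _ (by simp), add_zero,
        zero_add]
    · rw [DirectSum.lof_apply, DirectSum.lof_eq_of, DirectSum.lof_eq_of,
        DirectSum.of_eq_of_ne _ _ _ (by simp), DirectSum.of_eq_of_ne _ _ _ (by simp), zero_add,
        zero_add]
  constructor
  · intro h
    obtain ⟨h₁, h₂, h₃⟩ := ev a b c _ rfl
    obtain ⟨h₁', h₂', h₃'⟩ := ev a' b' c' _ h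
    exact ⟨h₁.symm.trans h₁', h₂.symm.trans h₂', h₃.symm.trans h₃'⟩
  · rintro ⟨rfl, rfl, rfl⟩
    rfl

theorem degreeTwoComponents_eq [FiniteDimensional ℝ 𝔤] [FiniteDimensional ℝ 𝔥]
    (μ : TotalSpace 𝔤 𝔥 E M) :
    degreeTwoComponents μ = (Cochain.onG (tensorEval 1 (μ (1, 1))),
      Cochain.onH (tensorEval 2 (μ (2, 0))), Cochain.onGG (tensorEval 2 (μ (2, 0)))) := rfl

theorem bijective_degreeTwoComponents [FiniteDimensional ℝ 𝔤] [FiniteDimensional ℝ 𝔥] :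
    Function.Bijective
      ((degreeTwoComponents : TotalSpace 𝔤 𝔥 E M →ₗ[ℝ] ComponentSpace 𝔤 𝔥 E M).domRestrict
        (totalDegree 𝔤 𝔥 E M 2)) := by
  constructor
  · rintro ⟨μ, hμ⟩ ⟨ν, hν⟩ h
    rw [LinearMap.domRestrict_apply, LinearMap.domRestrict_apply, degreeTwoComponents_eq,
      degreeTwoComponents_eq, Prod.mk.injEq, Prod.mk.injEq] at h
    obtain ⟨h₁, h₂, h₃⟩ := h
    have e₁ : μ (1, 1) = ν (1, 1) := tensorEval_injective 1 <| Cochain.ext_one fun x =>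
      LinearMap.congr_fun h₁ x
    have e₂ : μ (2, 0) = ν (2, 0) := tensorEval_injective 2 <| Cochain.ext_two
      (fun x => LinearMap.congr_fun h₂ x) (fun x y => congrArg (fun f => f ![x, y]) h₃)
    apply Subtype.ext
    change μ = ν
    rw [mem_totalDegree_two_iff.1 hμ, mem_totalDegree_two_iff.1 hν, e₁, e₂]
  · rintro ⟨f, g, k⟩
    obtain ⟨a, ha⟩ := tensorEval_surjective 1 (Cochain.ofG f : Cochain 𝔤 𝔥 1 (Form E M 1))
    obtain ⟨b, hb⟩ := tensorEval_surjective 2 (Cochain.ofHGG g k)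
    obtain ⟨h₁, h₂⟩ := incl_add_incl_apply a b
    refine ⟨⟨_, mem_totalDegree_two_iff.2 (by rw [h₁, h₂])⟩, ?_⟩
    rw [LinearMap.domRestrict_apply]
    dsimp only
    rw [degreeTwoComponents_eq, h₁, h₂, ha, hb]
    refine Prod.ext (LinearMap.ext fun x => rfl) (Prod.ext (LinearMap.ext fun h => rfl)
      (AlternatingMap.ext fun m => ?_))
    change k ![m 0, m 1] = k m
    congr 1
    ext i
    fin_cases i <;> rfl

/-! ### The total differential in degree two -/

variable [IsManifold 𝓘(ℝ, E) ∞ M]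

theorem dTot_incl (L : MinimalLieTwoAlgebra 𝔤 𝔥) (p q : ℕ)
    (t : Cochain 𝔤 𝔥 p ℝ ⊗[ℝ] Form E M q) :
    dTot L (TotalSpace.incl 𝔤 𝔥 E M p q t) =
      TotalSpace.incl 𝔤 𝔥 E M (p + 1) q ((ceD L p).rTensor (Form E M q) t) +
        (-1 : ℝ) ^ p • TotalSpace.incl 𝔤 𝔥 E M p (q + 1)
          ((Form.d : Form E M q →ₗ[ℝ] Form E M (q + 1)).lTensor (Cochain 𝔤 𝔥 p ℝ) t) := by
  rw [dTot, TotalSpace.incl, DirectSum.toModule_lof]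
  rfl

variable [FiniteDimensional ℝ E] [FiniteDimensional ℝ 𝔤] [FiniteDimensional ℝ 𝔥]

/-- The component equations of `d_tot μ = ϖ̃`, in bidegrees `(1, 2)`, `(2, 1)` and `(3, 0)`. -/
theorem dTot_eq_omegaTilde_iff (L : MinimalLieTwoAlgebra 𝔤 𝔥) (ϖ : Form E M 3)
    (v : 𝔤 →ₗ[ℝ] VectorFld E M) {μ : TotalSpace 𝔤 𝔥 E M} (hμ : μ ∈ totalDegree 𝔤 𝔥 E M 2) :
    dTot L μ = omegaTilde 𝔥 ϖ v ↔
      -cochainMap Form.d (tensorEval 1 (μ (1, 1))) = contractionCochain 𝔥 v 0 2 ϖ ∧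
      ceD L 1 (tensorEval 1 (μ (1, 1))) + cochainMap Form.d (tensorEval 2 (μ (2, 0))) =
        -contractionCochain 𝔥 v 1 1 ϖ ∧
      ceD L 2 (tensorEval 2 (μ (2, 0))) = contractionCochain 𝔥 v 2 0 ϖ := by
  have hd : ∀ (p q : ℕ) (t : Cochain 𝔤 𝔥 p ℝ ⊗[ℝ] Form E M q),
      tensorEval p ((Form.d : Form E M q →ₗ[ℝ] Form E M (q + 1)).lTensor (Cochain 𝔤 𝔥 p ℝ) t) =
        cochainMap Form.d (tensorEval p t) := fun p q t =>
    Subtype.ext (funext fun w => tensorEval_lTensor _ p t w)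
  generalize ha : μ (1, 1) = a
  generalize hb : μ (2, 0) = b
  have h₁ : dTot L μ = TotalSpace.incl 𝔤 𝔥 E M 1 2 ((-1 : ℝ) • Form.d.lTensor (Cochain 𝔤 𝔥 1 ℝ) a) +
      TotalSpace.incl 𝔤 𝔥 E M 2 1
        ((ceD L 1).rTensor (Form E M 1) a + Form.d.lTensor (Cochain 𝔤 𝔥 2 ℝ) b) +
      TotalSpace.incl 𝔤 𝔥 E M 3 0 ((ceD L 2).rTensor (Form E M 0) b) := by
    rw [mem_totalDegree_two_iff.1 hμ, ha, hb, map_add, dTot_incl, dTot_incl, map_smul, map_add,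
      pow_one, neg_one_sq, one_smul]
    abel
  have h₂ : omegaTilde 𝔥 ϖ v =
      TotalSpace.incl 𝔤 𝔥 E M 1 2 ((tensorEquiv 1).symm (contractionCochain 𝔥 v 0 2 ϖ)) +
      TotalSpace.incl 𝔤 𝔥 E M 2 1 ((tensorEquiv 2).symm ((-1 : ℝ) • contractionCochain 𝔥 v 1 1 ϖ)) +
      TotalSpace.incl 𝔤 𝔥 E M 3 0 ((tensorEquiv 3).symm (contractionCochain 𝔥 v 2 0 ϖ)) := by
    rw [omegaTilde, map_smul, incl_neg_one_smul, sub_eq_add_neg]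
  rw [h₁, h₂, incl_degree_three_inj, LinearEquiv.eq_symm_apply, LinearEquiv.eq_symm_apply,
    LinearEquiv.eq_symm_apply]
  change tensorEval 1 _ = _ ∧ tensorEval 2 _ = _ ∧ tensorEval 3 _ = _ ↔ _
  rw [map_smul, map_add, hd, hd, tensorEval_rTensor_ceD, tensorEval_rTensor_ceD]
  have hneg : ∀ {p q : ℕ} (ξ : Cochain 𝔤 𝔥 p (Form E M q)), (-1 : ℝ) • ξ = -ξ := fun ξ =>
    neg_one_smul ℝ ξ
  exact and_congr (by rw [← hneg]) (and_congr (by rw [← hneg]) Iff.rfl)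

end TotalDegreeTwo

/-! ### Moment maps and the comparison of the equations -/

section MomentMaps
variable {E : Type*} [NormedAddCommGroup E] [NormedSpace ℝ E] [FiniteDimensional ℝ E]
  {M : Type*} [TopologicalSpace M] [ChartedSpace E M] [IsManifold 𝓘(ℝ, E) ∞ M]
  {𝔤 𝔥 : Type*} [LieRing 𝔤] [LieAlgebra ℝ 𝔤] [AddCommGroup 𝔥] [Module ℝ 𝔥]

theorem Is2Plectic.contract_injective {ϖ : Form E M 3} (hϖ : Is2Plectic ϖ) {X Y : VectorFld E M}
    (h : Form.contract X ϖ = Form.contract Y ϖ) : X = Y :=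
  ContMDiffSection.ext fun p => hϖ.2 p (congrArg (fun α : Form E M 2 => α.1 p) h)

/-- By nondegeneracy, the vector field chosen in `hamVF` is the only possible one. -/
theorem Is2Plectic.hamVF_eq {ϖ : Form E M 3} (hϖ : Is2Plectic ϖ) (α : hamForms ϖ)
    {X : VectorFld E M} (h : Form.d α.1 = -Form.contract X ϖ) : hamVF α = X :=
  hϖ.contract_injective (neg_injective ((d_eq_neg_contract_hamVF α).symm.trans h))

/-- The equations of a moment map for a triple of linear maps, in terms of the vector fields `v x`
instead of Hamiltonian vector fields of Hamiltonian forms. -/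
structure IsMomentTriple (L : MinimalLieTwoAlgebra 𝔤 𝔥) (ϖ : Form E M 3)
    (v : 𝔤 →ₗ[ℝ] VectorFld E M) (c : ComponentSpace 𝔤 𝔥 E M) : Prop where
  d_g : ∀ x, Form.d (c.1 x) = -Form.contract (v x) ϖ
  d_h : ∀ h, Form.d (c.2.1 h) = 0
  d_gg : ∀ x y, Form.d (c.2.2 ![x, y]) =
    c.1 ⁅x, y⁆ - Form.contract (v y) (Form.contract (v x) ϖ)
  act : ∀ x h, c.2.1 (L.act x h) = 0
  trinary : ∀ x y z, c.2.1 (L.trinary ![x, y, z]) +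
      Form.contract (v z) (Form.contract (v y) (Form.contract (v x) ϖ)) =
    c.2.2 ![x, ⁅y, z⁆] - c.2.2 ![y, ⁅x, z⁆] + c.2.2 ![z, ⁅x, y⁆]

theorem exists_components_eq_iff {L : MinimalLieTwoAlgebra 𝔤 𝔥} {ϖ : Form E M 3}
    (hϖ : Is2Plectic ϖ) {v : 𝔤 →ₗ[ℝ] VectorFld E M} {c : ComponentSpace 𝔤 𝔥 E M} :
    (∃ φ : MomentMap L ϖ v, φ.components = c) ↔ IsMomentTriple L ϖ v c := by
  constructor
  · rintro ⟨φ, rfl⟩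
    have hd : ∀ x, Form.d (φ.f₁g x).1 = -Form.contract (v x) ϖ := fun x => (φ.moment x).symm
    have hX : ∀ x, hamVF (φ.f₁g x) = v x := fun x => hϖ.hamVF_eq _ (hd x)
    refine ⟨hd, φ.d_f₁h, fun x y => ?_, fun x h => ?_, fun x y z => ?_⟩
    · have := φ.d_f₂ x y
      rwa [bracket₂, hX, hX] at this
    · have := φ.f₁h_bracket h x
      rw [map_neg, eq_comm, neg_eq_zero] at this
      exact this
    · have := φ.f₁h_trinary x y z
      rwa [bracket₃, hX, hX, hX, sub_neg_eq_add] at this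
  · intro hc
    let f : 𝔤 →ₗ[ℝ] hamForms ϖ := c.1.codRestrict (hamForms ϖ) fun x => ⟨v x, hc.d_g x⟩
    have hX : ∀ x, hamVF (f x) = v x := fun x => hϖ.hamVF_eq _ (hc.d_g x)
    refine ⟨{ f₁g := f, f₁h := c.2.1, f₂ := c.2.2, d_f₁h := hc.d_h, d_f₂ := fun x y => ?_,
              f₁h_bracket := fun h x => ?_, f₁h_trinary := fun x y z => ?_,
              moment := fun x => (hc.d_g x).symm }, rfl⟩
    · rw [bracket₂, hX, hX]
      exact hc.d_gg x y
    · rw [map_neg, hc.act, neg_zero]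
    · rw [bracket₃, hX, hX, hX, sub_neg_eq_add]
      exact hc.trinary x y z

/-- A moment map carries no data besides its components; membership of `f₁ x` in the Hamiltonian
forms and the equations are propositions. -/
theorem MomentMap.components_injective {L : MinimalLieTwoAlgebra 𝔤 𝔥} {ϖ : Form E M 3}
    {v : 𝔤 →ₗ[ℝ] VectorFld E M} :
    Function.Injective (MomentMap.components : MomentMap L ϖ v → ComponentSpace 𝔤 𝔥 E M) := by
  rintro ⟨⟨f, g, k, _, _, _, _⟩, _⟩ ⟨⟨f', g', k', _, _, _, _⟩, _⟩ h
  rw [MomentMap.components, MomentMap.components, Prod.mk.injEq, Prod.mk.injEq] at h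
  obtain ⟨h₁, h₂, h₃⟩ := h
  have h₀ : f = f' := LinearMap.ext fun x => Subtype.ext (LinearMap.congr_fun h₁ x)
  dsimp only at h₂ h₃
  subst h₀ h₂ h₃
  rfl

/-- Bidegree `(1, 2)` gives the equation for `d (f₁ x)`, bidegree `(2, 1)` the ones for `d (f₁ h)`
and `d (f₂ (x, y))`, and bidegree `(3, 0)` the ones for `f₁ [h, x]` and `f₁ [x, y, z]`. -/
theorem dTot_eq_omegaTilde_iff_isMomentTriple [FiniteDimensional ℝ 𝔤] [FiniteDimensional ℝ 𝔥]
    (L : MinimalLieTwoAlgebra 𝔤 𝔥) (ϖ : Form E M 3)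
    (v : 𝔤 →ₗ[ℝ] VectorFld E M) {μ : TotalSpace 𝔤 𝔥 E M} (hμ : μ ∈ totalDegree 𝔤 𝔥 E M 2) :
    dTot L μ = omegaTilde 𝔥 ϖ v ↔ IsMomentTriple L ϖ v (degreeTwoComponents μ) := by
  rw [dTot_eq_omegaTilde_iff L ϖ v hμ, degreeTwoComponents_eq]
  generalize tensorEval 1 (μ (1, 1)) = A
  generalize tensorEval 2 (μ (2, 0)) = B
  constructor
  · rintro ⟨h₁, h₂, h₃⟩
    refine ⟨fun x => ?_, fun h => ?_, fun x y => ?_, fun x h => ?_, fun x y z => ?_⟩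
    · have e : -Form.d (A.1 [Sum.inr x]) = Form.contract (v x) ϖ :=
        congrArg (fun ξ : Cochain 𝔤 𝔥 1 (Form E M 2) => ξ.1 [Sum.inr x]) h₁
      exact neg_eq_iff_eq_neg.1 e
    · have e : (ceD L 1 A).1 [Sum.inl h] + Form.d (B.1 [Sum.inl h]) = -0 :=
        congrArg (fun ξ : Cochain 𝔤 𝔥 2 (Form E M 1) => ξ.1 [Sum.inl h]) h₂
      rwa [ceD_inl, zero_add, neg_zero] at e
    · have e : (ceD L 1 A).1 [Sum.inr x, Sum.inr y] + Form.d (B.1 [Sum.inr x, Sum.inr y]) =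
          -Form.contract (v y) (Form.contract (v x) ϖ) :=
        congrArg (fun ξ : Cochain 𝔤 𝔥 2 (Form E M 1) => ξ.1 [Sum.inr x, Sum.inr y]) h₂
      rw [ceD_inr_inr, neg_add_eq_iff_eq_add, ← sub_eq_add_neg] at e
      exact e
    · have e : (ceD L 2 B).1 [Sum.inr x, Sum.inl h] = 0 :=
        congrArg (fun ξ : Cochain 𝔤 𝔥 3 (Form E M 0) => ξ.1 [Sum.inr x, Sum.inl h]) h₃
      rw [ceD_inr_inl, neg_eq_zero] at e
      exact e
    · have e : (ceD L 2 B).1 [Sum.inr x, Sum.inr y, Sum.inr z] =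
          Form.contract (v z) (Form.contract (v y) (Form.contract (v x) ϖ)) :=
        congrArg (fun ξ : Cochain 𝔤 𝔥 3 (Form E M 0) => ξ.1 [Sum.inr x, Sum.inr y, Sum.inr z]) h₃
      rw [ceD_inr_inr_inr, sub_eq_iff_eq_add'] at e
      exact e.symm
  · rintro ⟨h₁, h₂, h₃, h₄, h₅⟩
    refine ⟨Cochain.ext_one fun x => ?_, Cochain.ext_two (fun h => ?_) fun x y => ?_,
      Cochain.ext_three (fun x h => ?_) fun x y z => ?_⟩
    · change -Form.d (A.1 [Sum.inr x]) = Form.contract (v x) ϖ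
      exact neg_eq_iff_eq_neg.2 (h₁ x)
    · change (ceD L 1 A).1 [Sum.inl h] + Form.d (B.1 [Sum.inl h]) = -0
      rw [ceD_inl, zero_add, neg_zero]
      exact h₂ h
    · change (ceD L 1 A).1 [Sum.inr x, Sum.inr y] + Form.d (B.1 [Sum.inr x, Sum.inr y]) =
          -Form.contract (v y) (Form.contract (v x) ϖ)
      rw [ceD_inr_inr, neg_add_eq_iff_eq_add, ← sub_eq_add_neg]
      exact h₃ x y
    · change (ceD L 2 B).1 [Sum.inr x, Sum.inl h] = 0
      rw [ceD_inr_inl, neg_eq_zero]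
      exact h₄ x h
    · change (ceD L 2 B).1 [Sum.inr x, Sum.inr y, Sum.inr z] =
          Form.contract (v z) (Form.contract (v y) (Form.contract (v x) ϖ))
      rw [ceD_inr_inr_inr, sub_eq_iff_eq_add']
      exact (h₅ x y z).symm

end MomentMaps

/-! ### The affine space of solutions -/

/-- The linear image of the solution set of an affine equation on a subspace is an affine subspace,
empty if there is no solution. -/
theorem exists_affineSubspace_of_linear_equation {k V V' C : Type*} [Field k]
    [AddCommGroup V] [Module k V] [AddCommGroup V'] [Module k V'] [AddCommGroup C] [Module k C]
    (S : Submodule k V) (D : V →ₗ[k] V') (b : V') (e : V →ₗ[k] C) :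
    ∃ A : AffineSubspace k C, (A : Set C) = e '' {μ | μ ∈ S ∧ D μ = b} ∧
      ((A : Set C).Nonempty → A.direction = (S ⊓ LinearMap.ker D).map e) := by
  rcases {μ | μ ∈ S ∧ D μ = b}.eq_empty_or_nonempty with h | ⟨μ₀, hS, hb⟩
  · exact ⟨⊥, by rw [h, Set.image_empty, AffineSubspace.bot_coe], fun ⟨x, hx⟩ => hx.elim⟩
  · refine ⟨AffineSubspace.mk' (e μ₀) ((S ⊓ LinearMap.ker D).map e), ?_,
      fun _ => AffineSubspace.direction_mk' _ _⟩
    ext c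
    rw [SetLike.mem_coe, AffineSubspace.mem_mk', vsub_eq_sub]
    constructor
    · rintro ⟨ν, ⟨hν, hν'⟩, h⟩
      exact ⟨ν + μ₀, ⟨S.add_mem hν hS, by rw [map_add, LinearMap.mem_ker.1 hν', zero_add, hb]⟩,
        by rw [map_add, h, sub_add_cancel]⟩
    · rintro ⟨μ, ⟨hμ, hμb⟩, rfl⟩
      exact ⟨μ - μ₀, ⟨S.sub_mem hμ hS, LinearMap.mem_ker.2 (by rw [map_sub, hμb, hb, sub_self])⟩,
        map_sub _ _ _⟩

theorem mainTheorem1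
    {E : Type*} [NormedAddCommGroup E] [NormedSpace ℝ E] [FiniteDimensional ℝ E]
    {M : Type*} [TopologicalSpace M] [T2Space M] [SecondCountableTopology M] [ConnectedSpace M]
    [ChartedSpace E M] [IsManifold 𝓘(ℝ, E) ∞ M]
    {𝔤 𝔥 : Type*} [LieRing 𝔤] [LieAlgebra ℝ 𝔤] [FiniteDimensional ℝ 𝔤]
    [AddCommGroup 𝔥] [Module ℝ 𝔥] [FiniteDimensional ℝ 𝔥]
    (L : MinimalLieTwoAlgebra 𝔤 𝔥)
    (ϖ : Form E M 3) (hϖ : Is2Plectic ϖ)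
    (v : 𝔤 →ₗ[ℝ] VectorFld E M) (hv : IsHamiltonianAction ϖ v) :
    -- an element of degree two is the same as its three components
    Function.Bijective
      ((degreeTwoComponents : TotalSpace 𝔤 𝔥 E M →ₗ[ℝ] ComponentSpace 𝔤 𝔥 E M).domRestrict
        (totalDegree 𝔤 𝔥 E M 2)) ∧
    -- it is a primitive iff these are the components of a moment map
    (∀ μ ∈ totalDegree 𝔤 𝔥 E M 2,
      dTot L μ = omegaTilde 𝔥 ϖ v ↔
        ∃ φ : MomentMap L ϖ v, φ.components = degreeTwoComponents μ) ∧
    -- the resulting bijection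
    (∃ Φ : {μ : TotalSpace 𝔤 𝔥 E M // μ ∈ totalDegree 𝔤 𝔥 E M 2 ∧ dTot L μ = omegaTilde 𝔥 ϖ v} ≃
        MomentMap L ϖ v,
      ∀ μ, (Φ μ).components = degreeTwoComponents μ.1) ∧
    -- the moment maps form an affine space, modelled on the closed elements of degree two
    (∃ A : AffineSubspace ℝ (ComponentSpace 𝔤 𝔥 E M),
      (A : Set (ComponentSpace 𝔤 𝔥 E M)) =
          Set.range (MomentMap.components : MomentMap L ϖ v → ComponentSpace 𝔤 𝔥 E M) ∧
        ((A : Set (ComponentSpace 𝔤 𝔥 E M)).Nonempty →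
          A.direction = (totalDegree 𝔤 𝔥 E M 2 ⊓ LinearMap.ker (dTot L)).map
            degreeTwoComponents)) := by
  have key : ∀ μ ∈ totalDegree 𝔤 𝔥 E M 2, dTot L μ = omegaTilde 𝔥 ϖ v ↔
      ∃ φ : MomentMap L ϖ v, φ.components = degreeTwoComponents μ := fun μ hμ =>
    (dTot_eq_omegaTilde_iff_isMomentTriple L ϖ v hμ).trans (exists_components_eq_iff hϖ).symm
  have bij := bijective_degreeTwoComponents (𝔤 := 𝔤) (𝔥 := 𝔥) (E := E) (M := M)
  have lift : ∀ φ : MomentMap L ϖ v, ∃ μ ∈ totalDegree 𝔤 𝔥 E M 2,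
      dTot L μ = omegaTilde 𝔥 ϖ v ∧ φ.components = degreeTwoComponents μ := fun φ => by
    obtain ⟨⟨μ, hμ⟩, h⟩ := bij.2 φ.components
    exact ⟨μ, hμ, (key μ hμ).2 ⟨φ, h.symm⟩, h.symm⟩
  refine ⟨bij, key, ?_, ?_⟩
  · choose Φ hΦ using fun μ : {μ : TotalSpace 𝔤 𝔥 E M // μ ∈ totalDegree 𝔤 𝔥 E M 2 ∧
      dTot L μ = omegaTilde 𝔥 ϖ v} => (key μ.1 μ.2.1).1 μ.2.2
    refine ⟨Equiv.ofBijective Φ ⟨fun μ ν h => ?_, fun φ => ?_⟩, hΦ⟩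
    · have h' : degreeTwoComponents μ.1 = degreeTwoComponents ν.1 := by rw [← hΦ, ← hΦ, h]
      exact Subtype.ext (Subtype.mk.inj (bij.1 (a₁ := ⟨μ.1, μ.2.1⟩) (a₂ := ⟨ν.1, ν.2.1⟩) h'))
    · obtain ⟨μ, hμ, hμ', h⟩ := lift φ
      exact ⟨⟨μ, hμ, hμ'⟩, MomentMap.components_injective ((hΦ _).trans h.symm)⟩
  · have himage : degreeTwoComponents '' {μ | μ ∈ totalDegree 𝔤 𝔥 E M 2 ∧
        dTot L μ = omegaTilde 𝔥 ϖ v} =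
        Set.range (MomentMap.components : MomentMap L ϖ v → ComponentSpace 𝔤 𝔥 E M) := by
      ext c
      constructor
      · rintro ⟨μ, ⟨hμ, hμ'⟩, rfl⟩
        exact (key μ hμ).1 hμ'
      · rintro ⟨φ, rfl⟩
        obtain ⟨μ, hμ, hμ', h⟩ := lift φ
        exact ⟨μ, ⟨hμ, hμ'⟩, h.symm⟩
    rw [← himage]
    exact exists_affineSubspace_of_linear_equation _ _ _ _
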